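/- For $i\in\mathbb Z$ let $P(-3,3,2i+1)$ be the three-column pretzel knot with $-3$, $3$ and $2i+1$ signed crossings in its columns. The $r$-th elementary ideal $E_r$ ($r\ge 1$) of a knot is the ideal of $\mathbb Z[t,t^{-1}]$ generated by the $(m-r+1)\times(m-r+1)$ minors of a presentation matrix, with $m$ generators, of the Alexander module of the knot (the whole ring if $m-r+1\le 0$). The Alexander polynomial is a generator of the smallest principal ideal containing $E_1$; it is defined up to multiplication by $\pm t^{n}$. 1. For every integer $i\ge 1$ the knot $P(-3,3,2i+1)$ has Alexander polynomial $2t^2-5t+2$. 2. The knots $P(-3,3,2i_k+1)$ with $i_k=3k-2$, $k=1,2,3,\dots$, all have the same elementary ideals $E_r$, $r\ge 1$; the second one, $E_2$, is the ideal $(t-2,\;2t-1)$ of $\mathbb Z[t,t^{-1}]$. 3. The knots $P(-3,3,2i_k+1)$ with $i_k=3k-1$, $k=1,2,3,\dots$, also all have the same elementary ideals $E_r$, $r\ge 1$; for them $E_2$ is the whole ring $\mathbb Z[t,t^{-1}]$. -/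

import Mathlib

/-!
Link diagrams, the knot group, the Alexander module, elementary ideals and the Alexander
polynomial.

A link diagram in the plane, in general position with respect to the height function, is read from
top to bottom as a sequence of elementary events.  At each height the strands that are cut are
numbered `0, 1, 2, ...` from left to right.
-/

/-- The elementary events met when a link diagram is read from top to bottom. -/
inductive MorseEvent where
  /-- A local maximum: two new strands, in positions `j` and `j + 1`. -/
  | cup (j : ℕ)
  /-- A local minimum: the strands in positions `j` and `j + 1` are joined and end. -/
  | cap (j : ℕ)
  /-- A crossing of the strands in positions `j` and `j + 1`.  For `right = true` the over-strand
  runs from the top right to the bottom left (a positive crossing when both strands are directed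
  downwards); for `right = false` it runs from the top left to the bottom right. -/
  | cross (j : ℕ) (right : Bool)

namespace MorseEvent

/-- The number of strands just below the event, if there are `n` strands just above it; `none` if
the event cannot take place among `n` strands. -/
def next (n : ℕ) : MorseEvent → Option ℕ
  | cup j => if j ≤ n then some (n + 2) else none
  | cap j => if j + 2 ≤ n then some (n - 2) else none
  | cross j _ => if j + 2 ≤ n then some n else none

/-- The Wirtinger relations at an event, as pairs `(u, v)` standing for `u = v`.  Here `a k` and
`b k` are the meridians of the `k`-th strand just above and just below the event.  Base point: the
eye of the reader; each meridian goes round its strand as if the strand were directed downwards, so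
that the two meridians at a local extremum are inverse to one another.  At a crossing the meridian
of the over-strand does not change, and the meridian of the under-strand is conjugated by it. -/
def relations {F : Type*} [Group F] (a b : ℕ → F) : MorseEvent → Set (F × F)
  | cup j =>
      {(b (j + 1), (b j)⁻¹)} ∪ {x | ∃ k < j, x = (b k, a k)} ∪ {x | ∃ k ≥ j, x = (b (k + 2), a k)}
  | cap j =>
      {(a (j + 1), (a j)⁻¹)} ∪ {x | ∃ k < j, x = (b k, a k)} ∪ {x | ∃ k ≥ j, x = (b k, a (k + 2))}
  | cross j true =>
      {(b j, a (j + 1)), (b (j + 1), (a (j + 1))⁻¹ * a j * a (j + 1))} ∪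
        {x | ∃ k, k ≠ j ∧ k ≠ j + 1 ∧ x = (b k, a k)}
  | cross j false =>
      {(b (j + 1), a j), (b j, a j * a (j + 1) * (a j)⁻¹)} ∪
        {x | ∃ k, k ≠ j ∧ k ≠ j + 1 ∧ x = (b k, a k)}

end MorseEvent

/-- The number of strands after reading the events of `w`, starting with `n` strands. -/
def strandCount (n : ℕ) (w : List MorseEvent) : Option ℕ :=
  w.foldlM MorseEvent.next n

/-- A link diagram: a sequence of events that starts and ends with no strand. -/
structure LinkDiagram where
  events : List MorseEvent
  closed : strandCount 0 events = some 0

namespace LinkDiagram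

variable (D : LinkDiagram)

/-- The number of strands of the diagram at level `l`, i.e. after the first `l` events. -/
def width (l : ℕ) : ℕ := (strandCount 0 (D.events.take l)).getD 0

/-- The pieces of strand of the diagram: `(l, j)` is the piece in position `j` at level `l`. -/
def Strand : Type := {x : ℕ × ℕ // x.1 ≤ D.events.length ∧ x.2 < D.width x.1}

/-- The generator attached to position `j` at level `l` (`1` if there is no strand there). -/
def gen (l j : ℕ) : FreeGroup D.Strand :=
  if h : l ≤ D.events.length ∧ j < D.width l then FreeGroup.of ⟨(l, j), h⟩ else 1

/-- The Wirtinger relators of the diagram. -/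
def relators : Set (FreeGroup D.Strand) :=
  {r | ∃ (l : ℕ) (e : MorseEvent), D.events[l]? = some e ∧
    ∃ x ∈ e.relations (D.gen l) (D.gen (l + 1)), r = x.1 * x.2⁻¹}

/-- The knot group, by its Wirtinger presentation. -/
abbrev knotGroup : Type := PresentedGroup D.relators

/-- The meridian of the left strand of the first (uppermost) local maximum, directed downwards.  For
the diagram of a knot, this choice of a directed strand is the choice of an orientation. -/
def meridian : D.knotGroup := PresentedGroup.mk D.relators (D.gen 1 0)

end LinkDiagram

/-- The abelian group `G' / G''`, written additively.  The element `g` of `G`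
determines the module structure below. -/
def MetabelianModule (G : Type*) [Group G] (_g : G) : Type _ :=
  Additive (Abelianization (commutator G))

namespace MetabelianModule

variable {G : Type*} [Group G] (g : G)

instance : AddCommGroup (MetabelianModule G g) :=
  inferInstanceAs (AddCommGroup (Additive (Abelianization (commutator G))))

/-- The class in `G' / G''` of an element of `G'`. -/
def mk (h : commutator G) : MetabelianModule G g := Additive.ofMul (Abelianization.of h)

/-- Conjugation by `g` on `G' / G''`. -/
def conj : MetabelianModule G g ≃ₗ[ℤ] MetabelianModule G g :=
  AddEquiv.toIntLinearEquiv
    (MulEquiv.toAdditive (MulAut.conjNormal (H := commutator G) g).abelianizationCongr)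

/-- The action of `ℤ[t, t⁻¹]` on `G' / G''` for which `t` acts as conjugation by `g`. -/
noncomputable def action :
    LaurentPolynomial ℤ →ₐ[ℤ] Module.End ℤ (MetabelianModule G g) :=
  AddMonoidAlgebra.lift ℤ (Module.End ℤ (MetabelianModule G g)) ℤ
    (LinearEquiv.automorphismGroup.toLinearMapMonoidHom.comp
      (zpowersHom (MetabelianModule G g ≃ₗ[ℤ] MetabelianModule G g) (conj g)))

noncomputable instance : Module (LaurentPolynomial ℤ) (MetabelianModule G g) :=
  Module.compHom _ (action g).toRingHom

theorem T_one_smul_mk (h : commutator G) :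
    (LaurentPolynomial.T 1 : LaurentPolynomial ℤ) • mk g h = mk g (MulAut.conjNormal g h) := by
  change action g (LaurentPolynomial.T 1) (mk g h) = _
  have h1 : action g (LaurentPolynomial.T 1) = (conj g).toLinearMap := by
    unfold action LaurentPolynomial.T
    rw [AddMonoidAlgebra.lift_single]
    simp [LinearEquiv.automorphismGroup.toLinearMapMonoidHom]
    rfl
  rw [h1]
  rfl

end MetabelianModule

/-- The Alexander module of (a diagram of) a knot: `G' / G''` for the knot group `G`, with `t` acting
as conjugation by a meridian.  This is the first homology group of the infinite cyclic cover of the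
knot complement, with `t` acting as the generator of the covering transformations. -/
abbrev LinkDiagram.AlexanderModule (D : LinkDiagram) : Type :=
  MetabelianModule D.knotGroup D.meridian

section ElementaryIdeals

variable {R : Type*} [CommRing R]

/-- `A` is a presentation matrix of `M`, with `m` generators (rows) and `n` relations (columns). -/
def IsPresentationMatrix {m n : ℕ} (A : Matrix (Fin m) (Fin n) R)
    (M : Type*) [AddCommGroup M] [Module R M] : Prop :=
  ∃ f : (Fin m → R) →ₗ[R] M, Function.Surjective f ∧
    LinearMap.ker f = LinearMap.range A.mulVecLin

/-- The ideal generated by the `k × k` minors of `A`. -/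
def minorIdeal {m n : ℕ} (k : ℕ) (A : Matrix (Fin m) (Fin n) R) : Ideal R :=
  Ideal.span {d | ∃ (r : Fin k → Fin m) (c : Fin k → Fin n), d = (A.submatrix r c).det}

/-- The `r`-th elementary ideal (`r ≥ 1`) of a finitely presented module `M`: the ideal generated by
the `(m - r + 1) × (m - r + 1)` minors of a presentation matrix of `M` with `m` generators (all of
`R` when `m - r + 1 ≤ 0`).  All presentation matrices give the same ideal; the supremum over them is
taken in order not to choose one. -/
noncomputable def elementaryIdeal (R : Type*) [CommRing R] (M : Type*) [AddCommGroup M] [Module R M] (r : ℕ) :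
    Ideal R :=
  sSup {I | ∃ (m n : ℕ) (A : Matrix (Fin m) (Fin n) R),
    IsPresentationMatrix A M ∧ I = minorIdeal (m + 1 - r) A}

end ElementaryIdeals

namespace LinkDiagram

/-- The `r`-th elementary ideal (Alexander ideal) of a knot. -/
noncomputable def alexanderIdeal (D : LinkDiagram) (r : ℕ) : Ideal (LaurentPolynomial ℤ) :=
  elementaryIdeal (LaurentPolynomial ℤ) D.AlexanderModule r

/-- `Δ` is the Alexander polynomial of the knot (which is defined up to units of `ℤ[t, t⁻¹]`): a
generator of the smallest principal ideal that contains the first elementary ideal. -/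
def IsAlexanderPolynomial (D : LinkDiagram) (Δ : LaurentPolynomial ℤ) : Prop :=
  IsLeast {I : Ideal (LaurentPolynomial ℤ) | Submodule.IsPrincipal I ∧ D.alexanderIdeal 1 ≤ I}
    (Ideal.span {Δ})

end LinkDiagram

/-- A column of `|n|` crossings between the strands in positions `j` and `j + 1`, all of the kind
given by the sign of `n`. -/
def twistColumn (j : ℕ) (n : ℤ) : List MorseEvent :=
  List.replicate n.natAbs (MorseEvent.cross j (decide (0 < n)))

theorem strandCount_twistColumn {j N : ℕ} (h : j + 2 ≤ N) (n : ℤ) :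
    strandCount N (twistColumn j n) = some N := by
  unfold twistColumn
  induction n.natAbs with
  | zero => rfl
  | succ k ih =>
    rw [List.replicate_succ, strandCount, List.foldlM_cons]
    simpa [MorseEvent.next, h, strandCount] using ih

theorem strandCount_append (N : ℕ) (v w : List MorseEvent) :
    strandCount N (v ++ w) = (strandCount N v).bind fun K => strandCount K w :=
  List.foldlM_append

/-- The standard diagram of the pretzel link `P(p, q, r)`: three vertical columns side by side with
`p`, `q` and `r` crossings; at the top and at the bottom, neighbouring columns are joined by an arc,
and an outer arc joins the first column to the third.  For `p`, `q`, `r` odd this is a knot, whose two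
strands in each column are oppositely directed. -/
def pretzel (p q r : ℤ) : LinkDiagram where
  events :=
    [.cup 0, .cup 1, .cup 3] ++ twistColumn 0 p ++ twistColumn 2 q ++ twistColumn 4 r ++
      [.cap 3, .cap 1, .cap 0]
  closed := by
    have h : strandCount 0 [.cup 0, .cup 1, .cup 3] = some 6 := rfl
    simp only [strandCount_append, h, Option.bind_some,
      strandCount_twistColumn (show 0 + 2 ≤ 6 by norm_num),
      strandCount_twistColumn (show 2 + 2 ≤ 6 by norm_num),
      strandCount_twistColumn (show 4 + 2 ≤ 6 by norm_num)]
    rfl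

/-! The group `G` of the pretzel knot `P(2a+1, 2b+1, 2c+1)` is generated by a meridian `x` and by
the products `v`, `w` of the two strand labels at the top of the first and second columns; the third
column then has product `(vw)⁻¹`. A crossing preserves the product of its two labels, so a full
twist conjugates both labels by a power of that product, and an odd column can be solved in closed
form. The three minima give three relations, one of which follows from the other two
(`reads_pretzel_columns_iff`).

In an abelian quotient these relations force `v = w = 1`, hence `v` and `w` lie in `G'`. Written in
`G'/G''`, with `t` acting as conjugation by `x`, they become the two columns of `pretzelMatrix`. No
further relation holds: the affine group of the cokernel of this matrix contains a solution of the
group relations, so `G` maps to it and `G'/G''` maps to the cokernel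
(`isPresentationMatrix_of_pretzelRelations`).

Elementary ideals do not depend on the presentation (`elementaryIdeal_eq_minorIdeal`), so `E_1` is
generated by the determinant, `E_2` by the entries, and `E_r` is everything for `r ≥ 3`. For `a =
-2`, `b = 1`, `c = i` the determinant is `(t - 2)(2t - 1)` whatever `i` is, while `E_2 = (t - 2, 2t
- 1, i - 1)`. Since `3 = (2t - 1) - 2(t - 2)`, only `i` modulo 3 matters: for `i ≡ 1` the last
generator is redundant, for `i ≡ 2` it is prime to 3 and `E_2` is the whole ring. -/

/-! ### Ideals of minors: products and block matrices -/

section MinorSpan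

variable {R : Type*} [CommRing R] {ι κ μ : Type*}

/-- The ideal generated by the `k × k` minors of a matrix with arbitrary index types. -/
def minorSpan (k : ℕ) (A : Matrix ι κ R) : Ideal R :=
  Ideal.span {d | ∃ (r : Fin k → ι) (c : Fin k → κ), d = (A.submatrix r c).det}

theorem det_submatrix_mem_minorSpan {k : ℕ} (A : Matrix ι κ R) (r : Fin k → ι) (c : Fin k → κ) :
    (A.submatrix r c).det ∈ minorSpan k A :=
  Ideal.subset_span ⟨r, c, rfl⟩

theorem minorSpan_le_iff {k : ℕ} {A : Matrix ι κ R} {I : Ideal R} :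
    minorSpan k A ≤ I ↔ ∀ (r : Fin k → ι) (c : Fin k → κ), (A.submatrix r c).det ∈ I := by
  rw [minorSpan, Ideal.span_le]
  constructor
  · intro h r c
    exact h ⟨r, c, rfl⟩
  · rintro h _ ⟨r, c, rfl⟩
    exact h r c

theorem minorIdeal_eq_minorSpan {m n : ℕ} (k : ℕ) (A : Matrix (Fin m) (Fin n) R) :
    minorIdeal k A = minorSpan k A := rfl

theorem minorSpan_zero (A : Matrix ι κ R) : minorSpan 0 A = ⊤ := by
  rw [Ideal.eq_top_iff_one]
  simpa using det_submatrix_mem_minorSpan A (Fin.elim0 : Fin 0 → ι) Fin.elim0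

theorem minorSpan_transpose (k : ℕ) (A : Matrix ι κ R) :
    minorSpan k A.transpose = minorSpan k A := by
  apply le_antisymm <;> rw [minorSpan_le_iff] <;> intro r c
  · rw [← Matrix.transpose_submatrix, Matrix.det_transpose]
    exact det_submatrix_mem_minorSpan A c r
  · rw [← Matrix.det_transpose, Matrix.transpose_submatrix]
    exact det_submatrix_mem_minorSpan A.transpose c r

/-- The columns of `A * C` are combinations of columns of `A`; expanding the determinant by
multilinearity writes it as a combination of minors of `A`. Minors with repeated columns are allowed
in `minorSpan`, so no Cauchy–Binet bookkeeping is needed. -/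
theorem minorSpan_mul_le_left [Fintype κ] (k : ℕ) (A : Matrix ι κ R) (C : Matrix κ μ R) :
    minorSpan k (A * C) ≤ minorSpan k A := by
  classical
  rw [minorSpan_le_iff]
  intro r c
  have h : ((A * C).submatrix r c).transpose =
      fun j => ∑ l, C l (c j) • (fun i => A (r i) l) := by
    ext j i
    simp [Matrix.mul_apply, mul_comm]
  rw [← Matrix.det_transpose, h]
  change Matrix.detRowAlternating.toMultilinearMap (fun j => ∑ l, C l (c j) • fun i => A (r i) l) ∈ _
  rw [MultilinearMap.map_sum]
  refine Ideal.sum_mem _ fun p _ => ?_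
  rw [MultilinearMap.map_smul_univ]
  refine Ideal.mul_mem_left _ _ ?_
  change (A.submatrix r p).transpose.det ∈ _
  rw [Matrix.det_transpose]
  exact det_submatrix_mem_minorSpan A r p

theorem minorSpan_mul_le_right [Fintype κ] (k : ℕ) (A : Matrix ι κ R) (C : Matrix κ μ R) :
    minorSpan k (A * C) ≤ minorSpan k C := by
  rw [← minorSpan_transpose, Matrix.transpose_mul, ← minorSpan_transpose k C]
  exact minorSpan_mul_le_left k _ _

/-- Iterated expansion of a determinant along all but `k` columns. -/
theorem det_mem_of_column_minors_mem (k : ℕ) (I : Ideal R) (s : ℕ)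
    (N : Matrix (Fin (k + s)) (Fin (k + s)) R) (e : Fin k → Fin (k + s))
    (he : Function.Injective e) (h : ∀ r : Fin k → Fin (k + s), (N.submatrix r e).det ∈ I) :
    N.det ∈ I := by
  induction s with
  | zero =>
    let σ : Equiv.Perm (Fin k) := Equiv.ofBijective e (Finite.injective_iff_bijective.mp he)
    have h1 := h σ
    have h2 : N.submatrix σ e = N.submatrix σ σ := rfl
    rwa [h2, Matrix.det_submatrix_equiv_self σ N] at h1
  | succ s ih =>
    obtain ⟨j, hj⟩ : ∃ j, j ∉ Set.range e := by
      by_contra! hc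
      have := Fintype.card_le_of_surjective e (fun x => hc x)
      simp at this
    have hf : ∀ i, ∃ x, (Fin.succAbove j x) = e i := fun i =>
      Fin.exists_succAbove_eq fun hij => hj ⟨i, hij⟩
    choose e' he' using hf
    rw [Matrix.det_succ_column (n := k + s) N j]
    refine Ideal.sum_mem _ fun i _ => Ideal.mul_mem_left _ _ ?_
    refine ih _ e' (fun a b hab => he ?_) fun r => ?_
    · rw [← he', ← he', hab]
    · have : ((N.submatrix (Fin.succAbove i) (Fin.succAbove j)).submatrix r e') =
          N.submatrix (Fin.succAbove i ∘ r) e := by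
        ext a b
        simp [he']
      rw [this]
      exact h _

/-- A nonzero `l × l` minor uses distinct columns, at most `m` of them from the identity block,
hence at least `k` from the block of `B`. Expanding along the others leaves `k × k` minors on these
columns; each is a minor of `B` or has a zero row. -/
theorem minorSpan_fromBlocks_one_le {m : ℕ} [Fintype ι] [DecidableEq ι] (hm : Fintype.card ι = m)
    (B : Matrix κ μ R) {k l : ℕ} (hkl : k + m ≤ l) :
    minorSpan l (Matrix.fromBlocks (1 : Matrix ι ι R) 0 0 B) ≤ minorSpan k B := by
  classical
  rw [minorSpan_le_iff]
  intro r c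
  by_cases hc : Function.Injective c
  swap
  · obtain ⟨i, j, hij, hne⟩ := Function.not_injective_iff.mp hc
    rw [Matrix.det_zero_of_column_eq hne fun x => by simp [hij]]
    exact zero_mem _
  obtain ⟨s, rfl⟩ : ∃ s, l = k + s := ⟨l - k, by omega⟩
  have hcard : k ≤ Fintype.card {i // (c i).isRight} := by
    have h1 : Fintype.card {i // ¬ (c i).isRight} ≤ m := by
      rw [← hm]
      have hl : ∀ x : {i // ¬ (c i).isRight}, ∃ y, c x = Sum.inl y := by
        rintro ⟨x, hx⟩
        simpa [Sum.isLeft_iff] using hx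
      choose y hy using hl
      refine Fintype.card_le_of_injective y fun a b hab => ?_
      apply Subtype.ext
      apply hc
      rw [hy, hy, hab]
    have h2 := Fintype.card_subtype_compl (fun i => (c i).isRight = true)
    rw [Fintype.card_fin] at h2
    omega
  obtain ⟨g⟩ := Function.Embedding.nonempty_of_card_le (α := Fin k) (by simpa using hcard)
  have hy : ∀ i, ∃ y, c (g i) = Sum.inr y := fun i => Sum.isRight_iff.mp (g i).2
  choose y hy using hy
  refine det_mem_of_column_minors_mem k _ s _ (fun i => (g i : Fin (k + s)))
    (Subtype.val_injective.comp g.injective) fun q => ?_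
  by_cases hq : ∀ i, ∃ x, r (q i) = Sum.inr x
  · choose x hx using hq
    have : ((Matrix.fromBlocks (1 : Matrix ι ι R) 0 0 B).submatrix r c).submatrix q
        (fun i => (g i : Fin (k + s))) = B.submatrix x y := by
      ext a b
      simp [hx, hy]
    rw [this]
    exact det_submatrix_mem_minorSpan B x y
  · push Not at hq
    obtain ⟨i, hi⟩ := hq
    rw [Matrix.det_eq_zero_of_row_eq_zero i]
    · exact zero_mem _
    · intro j
      rcases h : r (q i) with x | x
      · simp [h, hy]
      · exact absurd h (hi x)

theorem minorSpan_le_minorSpan_fromBlocks_one {m : ℕ} (A : Matrix ι κ R)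
    (X : Matrix ι (Fin m) R) (k : ℕ) :
    minorSpan k A ≤ minorSpan (k + m)
      (Matrix.fromBlocks A X 0 (1 : Matrix (Fin m) (Fin m) R)) := by
  rw [minorSpan_le_iff]
  intro r c
  have h := det_submatrix_mem_minorSpan (Matrix.fromBlocks A X 0 (1 : Matrix (Fin m) (Fin m) R))
    (Sum.map r id ∘ finSumFinEquiv.symm : Fin (k + m) → _)
    (Sum.map c id ∘ finSumFinEquiv.symm : Fin (k + m) → _)
  rw [← Matrix.submatrix_submatrix, Matrix.det_submatrix_equiv_self] at h
  have h2 : (Matrix.fromBlocks A X 0 (1 : Matrix (Fin m) (Fin m) R)).submatrix (Sum.map r id)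
      (Sum.map c id) = Matrix.fromBlocks (A.submatrix r c) (X.submatrix r id) 0 1 := by
    ext (i | i) (j | j) <;> simp
  rwa [h2, Matrix.det_fromBlocks_zero₂₁, Matrix.det_one, mul_one] at h

end MinorSpan

/-! ### Independence of elementary ideals from the presentation -/

section Fitting

variable {R : Type*} [CommRing R] {M : Type*} [AddCommGroup M] [Module R M]

/-- Both presentations are compared with one on the union of the two generating families. The matrix
`A'` bordering `A` has columns that are joint relations, and every joint relation is a combination
of the columns of `L * D`, where `D` borders `B` by an identity. -/
theorem minorIdeal_le_of_isPresentationMatrix {m n m' n' : ℕ} {A : Matrix (Fin m) (Fin n) R}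
    {B : Matrix (Fin m') (Fin n') R} (hA : IsPresentationMatrix A M)
    (hB : IsPresentationMatrix B M) (r : ℕ) :
    minorIdeal (m + 1 - r) A ≤ minorIdeal (m' + 1 - r) B := by
  rw [minorIdeal_eq_minorSpan, minorIdeal_eq_minorSpan]
  -- Natural subtraction truncates: the comparison of minor sizes at the end, `m' + 1 - r + m ≤ m +
  -- 1 - r + m'`, needs `m' + 1 - r` to be positive.
  rcases Nat.eq_zero_or_pos (m' + 1 - r) with h0 | hpos
  · rw [h0, minorSpan_zero]
    exact le_top
  obtain ⟨f, hf, hfk⟩ := hA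
  obtain ⟨g, hg, hgk⟩ := hB
  -- Each family of generators is expressed through the other one.
  choose P hP using fun j : Fin m' => hf (g (Pi.single j 1))
  choose Q hQ using fun i : Fin m => hg (f (Pi.single i 1))
  let Pm : Matrix (Fin m) (Fin m') R := Matrix.of fun i j => P j i
  let Qm : Matrix (Fin m') (Fin m) R := Matrix.of fun i j => Q j i
  have hQv : ∀ v, g (Qm.mulVec v) = f v := by
    intro v
    have h1 : g ∘ₗ Qm.mulVecLin = f := by
      refine LinearMap.pi_ext' fun i => LinearMap.ext_ring ?_
      simp only [LinearMap.comp_apply, LinearMap.single_apply, Matrix.mulVecLin_apply,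
        Matrix.mulVec_single_one]
      exact hQ i
    exact LinearMap.congr_fun h1 v
  let L : Matrix (Fin m ⊕ Fin m') (Fin m ⊕ Fin m') R := Matrix.fromBlocks 1 0 (-Qm) 1
  let D : Matrix (Fin m ⊕ Fin m') (Fin m ⊕ Fin n') R := Matrix.fromBlocks 1 0 0 B
  have key : ∀ (v : Fin m ⊕ Fin m' → R), f (v ∘ Sum.inl) + g (v ∘ Sum.inr) = 0 →
      ∃ c, (L * D).mulVec c = v := by
    intro v hv
    have h1 : g (v ∘ Sum.inr + Qm.mulVec (v ∘ Sum.inl)) = 0 := by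
      rw [map_add, hQv, add_comm, hv]
    obtain ⟨c, hc⟩ : v ∘ Sum.inr + Qm.mulVec (v ∘ Sum.inl) ∈ LinearMap.range B.mulVecLin := by
      rw [← hgk]
      exact h1
    refine ⟨Sum.elim (v ∘ Sum.inl) c, ?_⟩
    rw [Matrix.mulVecLin_apply] at hc
    simp only [L, D, Matrix.fromBlocks_multiply, Matrix.fromBlocks_mulVec]
    ext (i | i)
    · simp
    · simp [hc, Matrix.neg_mulVec]
  let A' : Matrix (Fin m ⊕ Fin m') (Fin n ⊕ Fin m') R := Matrix.fromBlocks A (-Pm) 0 1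
  have hcol : ∀ j, ∃ c, (L * D).mulVec c = fun i => A' i j := by
    intro j
    apply key
    rcases j with j | j
    · have h1 : A.mulVecLin (Pi.single j 1) ∈ LinearMap.ker f := by
        rw [hfk]
        exact ⟨_, rfl⟩
      rw [LinearMap.mem_ker, Matrix.mulVecLin_apply, Matrix.mulVec_single_one] at h1
      have h2 : (fun i => A' i (Sum.inl j)) ∘ Sum.inl = A.col j := rfl
      have h3 : (fun i => A' i (Sum.inl j)) ∘ Sum.inr = 0 := rfl
      rw [h2, h3, h1, map_zero, add_zero]
    · have h2 : (fun i => A' i (Sum.inr j)) ∘ Sum.inl = -P j := rfl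
      have h3 : (fun i => A' i (Sum.inr j)) ∘ Sum.inr = Pi.single j 1 := by
        ext i
        simp [A', Matrix.one_apply, Pi.single_apply]
      rw [h2, h3, map_neg, hP, neg_add_cancel]
  choose C hC using hcol
  have hfac : A' = L * D * Matrix.of fun i j => C j i := by
    ext i j
    rw [← congrFun (hC j) i]
    rfl
  calc minorSpan (m + 1 - r) A ≤ minorSpan (m + 1 - r + m') A' :=
        minorSpan_le_minorSpan_fromBlocks_one _ _ _
    _ ≤ minorSpan (m + 1 - r + m') (L * D) := by
        rw [hfac]
        exact minorSpan_mul_le_left _ _ _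
    _ ≤ minorSpan (m + 1 - r + m') D := minorSpan_mul_le_right _ _ _
    _ ≤ minorSpan (m' + 1 - r) B :=
        minorSpan_fromBlocks_one_le (Fintype.card_fin m) B (by omega)

theorem elementaryIdeal_eq_minorIdeal {m n : ℕ} {A : Matrix (Fin m) (Fin n) R}
    (hA : IsPresentationMatrix A M) (r : ℕ) :
    elementaryIdeal R M r = minorIdeal (m + 1 - r) A := by
  apply le_antisymm
  · refine sSup_le ?_
    rintro _ ⟨m', n', B, hB, rfl⟩
    exact minorIdeal_le_of_isPresentationMatrix hB hA r
  · exact le_sSup ⟨m, n, A, hA, rfl⟩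

theorem minorIdeal_self {m : ℕ} (A : Matrix (Fin m) (Fin m) R) :
    minorIdeal m A = Ideal.span {A.det} := by
  apply le_antisymm
  · rw [minorIdeal_eq_minorSpan, minorSpan_le_iff]
    intro r c
    -- Selecting rows and columns is multiplication by 0-1 matrices, so every minor of full size is
    -- a multiple of `A.det`.
    have h : A.submatrix r c = (1 : Matrix _ _ R).submatrix r id * A * (1 : Matrix _ _ R).submatrix id c := by
      ext i j
      simp [Matrix.mul_apply, Matrix.one_apply]
    rw [h, Matrix.det_mul, Matrix.det_mul, Ideal.mem_span_singleton]
    exact Dvd.intro_left _ rfl |>.mul_right _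
  · rw [Ideal.span_singleton_le_iff_mem]
    exact Ideal.subset_span ⟨id, id, by simp⟩

theorem minorIdeal_one {m n : ℕ} (A : Matrix (Fin m) (Fin n) R) :
    minorIdeal 1 A = Ideal.span {d | ∃ i j, d = A i j} := by
  rw [minorIdeal]
  congr 1
  ext d
  constructor
  · rintro ⟨r, c, rfl⟩
    exact ⟨r 0, c 0, by simp⟩
  · rintro ⟨i, j, rfl⟩
    exact ⟨fun _ => i, fun _ => j, by simp⟩

end Fitting

/-! ### Labellings of diagrams by group elements -/

namespace MorseEvent

section Pair

variable {F : Type*}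

/-- Replace the labels in positions `j` and `j + 1` by `p` and `q`. -/
def setPair (j : ℕ) (p q : F) (a : ℕ → F) : ℕ → F :=
  fun k => if k = j then p else if k = j + 1 then q else a k

@[simp] theorem setPair_left (j : ℕ) (p q : F) (a : ℕ → F) : setPair j p q a j = p := by
  simp [setPair]

@[simp] theorem setPair_right (j : ℕ) (p q : F) (a : ℕ → F) : setPair j p q a (j + 1) = q := by
  simp [setPair]

theorem setPair_of_ne {j k : ℕ} (p q : F) (a : ℕ → F) (h : k ≠ j) (h' : k ≠ j + 1) :
    setPair j p q a k = a k := by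
  simp [setPair, h, h']

@[simp] theorem setPair_setPair (j : ℕ) (p q p' q' : F) (a : ℕ → F) :
    setPair j p q (setPair j p' q' a) = setPair j p q a := by
  ext k
  unfold setPair
  split_ifs <;> rfl

@[simp] theorem setPair_self (j : ℕ) (a : ℕ → F) : setPair j (a j) (a (j + 1)) a = a := by
  ext k
  unfold setPair
  split_ifs with h1 h2
  · rw [h1]
  · rw [h2]
  · rfl

theorem eq_setPair_iff {j : ℕ} {p q : F} {a b : ℕ → F} :
    b = setPair j p q a ↔ b j = p ∧ b (j + 1) = q ∧ ∀ k, k ≠ j → k ≠ j + 1 → b k = a k := by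
  constructor
  · rintro rfl
    exact ⟨setPair_left .., setPair_right .., fun k h h' => setPair_of_ne p q a h h'⟩
  · rintro ⟨h1, h2, h3⟩
    ext k
    unfold setPair
    split_ifs with h h'
    · rw [h, h1]
    · rw [h', h2]
    · exact h3 k h h'

end Pair

variable {F : Type*} [Group F]

/-- The labels `a` above and `b` below the event satisfy its Wirtinger relations. -/
def Relates (e : MorseEvent) (a b : ℕ → F) : Prop :=
  ∀ x ∈ e.relations a b, x.1 = x.2

theorem relates_cup_iff {j : ℕ} {a b : ℕ → F} :
    (cup j).Relates a b ↔
      b (j + 1) = (b j)⁻¹ ∧ (∀ k < j, b k = a k) ∧ ∀ k ≥ j, b (k + 2) = a k := by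
  simp only [Relates, relations]
  constructor
  · intro h
    exact ⟨h _ (Or.inl (Or.inl rfl)), fun k hk => h _ (Or.inl (Or.inr ⟨k, hk, rfl⟩)),
      fun k hk => h _ (Or.inr ⟨k, hk, rfl⟩)⟩
  · rintro ⟨h1, h2, h3⟩ x ((rfl | ⟨k, hk, rfl⟩) | ⟨k, hk, rfl⟩)
    exacts [h1, h2 k hk, h3 k hk]

theorem relates_cap_iff {j : ℕ} {a b : ℕ → F} :
    (cap j).Relates a b ↔
      a (j + 1) = (a j)⁻¹ ∧ b = fun k => if k < j then a k else a (k + 2) := by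
  simp only [Relates, relations]
  constructor
  · intro h
    refine ⟨h _ (Or.inl (Or.inl rfl)), ?_⟩
    ext k
    split_ifs with hk
    · exact h _ (Or.inl (Or.inr ⟨k, hk, rfl⟩))
    · exact h _ (Or.inr ⟨k, not_lt.mp hk, rfl⟩)
  · rintro ⟨h1, rfl⟩ x ((rfl | ⟨k, hk, rfl⟩) | ⟨k, hk, rfl⟩)
    · exact h1
    · simp [hk]
    · simp [not_lt.mpr hk]

theorem relates_cross_true_iff {j : ℕ} {a b : ℕ → F} :
    (cross j true).Relates a b ↔
      b = setPair j (a (j + 1)) ((a (j + 1))⁻¹ * a j * a (j + 1)) a := by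
  rw [eq_setPair_iff]
  simp only [Relates, relations]
  constructor
  · intro h
    exact ⟨h _ (Or.inl (Or.inl rfl)), h _ (Or.inl (Or.inr rfl)),
      fun k hk hk' => h _ (Or.inr ⟨k, hk, hk', rfl⟩)⟩
  · rintro ⟨h1, h2, h3⟩ x ((rfl | rfl) | ⟨k, hk, hk', rfl⟩)
    exacts [h1, h2, h3 k hk hk']

theorem relates_cross_false_iff {j : ℕ} {a b : ℕ → F} :
    (cross j false).Relates a b ↔
      b = setPair j (a j * a (j + 1) * (a j)⁻¹) (a j) a := by
  rw [eq_setPair_iff]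
  simp only [Relates, relations]
  constructor
  · intro h
    exact ⟨h _ (Or.inl (Or.inr rfl)), h _ (Or.inl (Or.inl rfl)),
      fun k hk hk' => h _ (Or.inr ⟨k, hk, hk', rfl⟩)⟩
  · rintro ⟨h1, h2, h3⟩ x ((rfl | rfl) | ⟨k, hk, hk', rfl⟩)
    exacts [h2, h1, h3 k hk hk']

theorem map_mem_relations {F' : Type*} [Group F'] (φ : F →* F') {a b : ℕ → F} {a' b' : ℕ → F'}
    (ha : ∀ k, φ (a k) = a' k) (hb : ∀ k, φ (b k) = b' k) {e : MorseEvent} {x : F × F}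
    (hx : x ∈ e.relations a b) : (φ x.1, φ x.2) ∈ e.relations a' b' := by
  obtain rfl : (fun k => φ (a k)) = a' := funext ha
  obtain rfl : (fun k => φ (b k)) = b' := funext hb
  rcases e with j | j | ⟨j, _ | _⟩
  · rcases hx with (rfl | ⟨k, hk, rfl⟩) | ⟨k, hk, rfl⟩
    · exact Or.inl (Or.inl (by simp))
    · exact Or.inl (Or.inr ⟨k, hk, rfl⟩)
    · exact Or.inr ⟨k, hk, rfl⟩
  · rcases hx with (rfl | ⟨k, hk, rfl⟩) | ⟨k, hk, rfl⟩
    · exact Or.inl (Or.inl (by simp))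
    · exact Or.inl (Or.inr ⟨k, hk, rfl⟩)
    · exact Or.inr ⟨k, hk, rfl⟩
  · rcases hx with (rfl | rfl) | ⟨k, hk, hk', rfl⟩
    · exact Or.inl (Or.inl rfl)
    · exact Or.inl (Or.inr (by simp))
    · exact Or.inr ⟨k, hk, hk', rfl⟩
  · rcases hx with (rfl | rfl) | ⟨k, hk, hk', rfl⟩
    · exact Or.inl (Or.inl rfl)
    · exact Or.inl (Or.inr (by simp))
    · exact Or.inr ⟨k, hk, hk', rfl⟩

/-- The event does not create strands. -/
def IsNotCup : MorseEvent → Prop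
  | cup _ => False
  | cap _ => True
  | cross _ _ => True

/-- Only a maximum introduces a new label; at the other events the labels below are words in those
above. -/
theorem Relates.mem_of_isNotCup {e : MorseEvent} (he : e.IsNotCup) {a b : ℕ → F}
    (h : e.Relates a b) {H : Subgroup F} (ha : ∀ k, a k ∈ H) (k : ℕ) : b k ∈ H := by
  rcases e with j | j | ⟨j, _ | _⟩
  · exact he.elim
  · rw [(relates_cap_iff.mp h).2]
    dsimp only
    split_ifs
    exacts [ha _, ha _]
  · rw [relates_cross_false_iff.mp h]
    unfold setPair
    split_ifs
    exacts [mul_mem (mul_mem (ha _) (ha _)) (inv_mem (ha _)), ha _, ha _]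
  · rw [relates_cross_true_iff.mp h]
    unfold setPair
    split_ifs
    exacts [ha _, mul_mem (mul_mem (inv_mem (ha _)) (ha _)) (ha _), ha _]

/-- If the labels above the event are trivial outside the `n` strands, so are those below it. -/
theorem Relates.eq_one_of_next {e : MorseEvent} {n n' : ℕ} (hn : e.next n = some n') {a b : ℕ → F}
    (h : e.Relates a b) (ha : ∀ k ≥ n, a k = 1) : ∀ k ≥ n', b k = 1 := by
  intro k hk
  rcases e with j | j | ⟨j, s⟩
  · simp only [next, Option.ite_none_right_eq_some, Option.some.injEq] at hn
    obtain ⟨k, rfl⟩ : ∃ i, k = i + 2 := ⟨k - 2, by omega⟩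
    rw [(relates_cup_iff.mp h).2.2 k (by omega)]
    exact ha k (by omega)
  · simp only [next, Option.ite_none_right_eq_some, Option.some.injEq] at hn
    rw [(relates_cap_iff.mp h).2]
    dsimp only
    rw [if_neg (by omega)]
    exact ha _ (by omega)
  · simp only [next, Option.ite_none_right_eq_some, Option.some.injEq] at hn
    cases s
    · rw [relates_cross_false_iff.mp h, setPair_of_ne _ _ _ (by omega) (by omega)]
      exact ha k (by omega)
    · rw [relates_cross_true_iff.mp h, setPair_of_ne _ _ _ (by omega) (by omega)]
      exact ha k (by omega)

/-- The labels `a` above and `b` below a sequence of events can be completed to labels that satisfy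
all the Wirtinger relations in between. -/
def Reads : List MorseEvent → (ℕ → F) → (ℕ → F) → Prop
  | [], a, b => b = a
  | e :: w, a, b => ∃ c, e.Relates a c ∧ Reads w c b

theorem reads_append {v w : List MorseEvent} {a b : ℕ → F} :
    Reads (v ++ w) a b ↔ ∃ c, Reads v a c ∧ Reads w c b := by
  induction v generalizing a with
  | nil => simp [Reads]
  | cons e v ih =>
    simp only [List.cons_append, Reads, ih]
    constructor
    · rintro ⟨c, h, d, h1, h2⟩
      exact ⟨d, ⟨c, h, h1⟩, h2⟩
    · rintro ⟨d, ⟨c, h, h1⟩, h2⟩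
      exact ⟨c, h, d, h1, h2⟩

theorem reads_of_labels {w : List MorseEvent} (lab : ℕ → ℕ → F)
    (h : ∀ (l : ℕ) (e : MorseEvent), w[l]? = some e → e.Relates (lab l) (lab (l + 1))) :
    Reads w (lab 0) (lab w.length) := by
  induction w generalizing lab with
  | nil => rfl
  | cons e w ih =>
    exact ⟨lab 1, h 0 e rfl, ih (fun l => lab (l + 1)) fun l e' he' =>
      h (l + 1) e' (by simpa using he')⟩

theorem Reads.exists_labels {w : List MorseEvent} {a b : ℕ → F} (h : Reads w a b) :
    ∃ lab : ℕ → ℕ → F, lab 0 = a ∧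
      ∀ (l : ℕ) (e : MorseEvent), w[l]? = some e → e.Relates (lab l) (lab (l + 1)) := by
  induction w generalizing a with
  | nil => exact ⟨fun _ => a, rfl, by simp⟩
  | cons e w ih =>
    obtain ⟨c, hc, hw⟩ := h
    obtain ⟨lab, h0, hlab⟩ := ih hw
    refine ⟨fun l => Nat.casesOn l a lab, rfl, ?_⟩
    rintro (_ | l) e' he'
    · obtain rfl : e = e' := by simpa using he'
      change e.Relates a (lab 0)
      rwa [h0]
    · exact hlab l e' (by simpa using he')

section Twist

variable {j : ℕ} {a b : ℕ → F}

/-- The product of the two labels is unchanged by a crossing, and two crossings conjugate both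
labels by it; induction then only accumulates a power of one fixed element. -/
theorem reads_two_mul_cross_true (m : ℕ) :
    Reads (List.replicate (2 * m) (cross j true)) a b ↔
      b = setPair j (((a j * a (j + 1)) ^ m)⁻¹ * a j * (a j * a (j + 1)) ^ m)
        (((a j * a (j + 1)) ^ m)⁻¹ * a (j + 1) * (a j * a (j + 1)) ^ m) a := by
  induction m generalizing a with
  | zero => simp [Reads]
  | succ m ih =>
    rw [show 2 * (m + 1) = 2 * m + 1 + 1 by ring]
    simp only [List.replicate_succ, Reads, relates_cross_true_iff, exists_eq_left, ih,
      setPair_left, setPair_right, setPair_setPair]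
    have h1 : (a (j + 1))⁻¹ * a j * a (j + 1) *
        (((a (j + 1))⁻¹ * a j * a (j + 1))⁻¹ * a (j + 1) * ((a (j + 1))⁻¹ * a j * a (j + 1))) =
        a j * a (j + 1) := by group
    rw [h1, pow_succ' (a j * a (j + 1)) m]
    generalize (a j * a (j + 1)) ^ m = W
    have h2 : W⁻¹ * ((a (j + 1))⁻¹ * a j * a (j + 1)) * W =
        (a j * a (j + 1) * W)⁻¹ * a j * (a j * a (j + 1) * W) := by group
    have h3 : W⁻¹ * (((a (j + 1))⁻¹ * a j * a (j + 1))⁻¹ * a (j + 1) *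
        ((a (j + 1))⁻¹ * a j * a (j + 1))) * W =
        (a j * a (j + 1) * W)⁻¹ * a (j + 1) * (a j * a (j + 1) * W) := by group
    rw [h2, h3]

theorem reads_two_mul_cross_false (m : ℕ) :
    Reads (List.replicate (2 * m) (cross j false)) a b ↔
      b = setPair j ((a j * a (j + 1)) ^ m * a j * ((a j * a (j + 1)) ^ m)⁻¹)
        ((a j * a (j + 1)) ^ m * a (j + 1) * ((a j * a (j + 1)) ^ m)⁻¹) a := by
  induction m generalizing a with
  | zero => simp [Reads]
  | succ m ih =>
    rw [show 2 * (m + 1) = 2 * m + 1 + 1 by ring]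
    simp only [List.replicate_succ, Reads, relates_cross_false_iff, exists_eq_left, ih,
      setPair_left, setPair_right, setPair_setPair]
    have h1 : a j * a (j + 1) * (a j)⁻¹ * a j * (a j * a (j + 1) * (a j)⁻¹)⁻¹ *
        (a j * a (j + 1) * (a j)⁻¹) = a j * a (j + 1) := by group
    rw [h1, pow_succ (a j * a (j + 1)) m]
    generalize (a j * a (j + 1)) ^ m = W
    have h2 : W * (a j * a (j + 1) * (a j)⁻¹ * a j * (a j * a (j + 1) * (a j)⁻¹)⁻¹) * W⁻¹ =
        W * (a j * a (j + 1)) * a j * (W * (a j * a (j + 1)))⁻¹ := by group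
    have h3 : W * (a j * a (j + 1) * (a j)⁻¹) * W⁻¹ =
        W * (a j * a (j + 1)) * a (j + 1) * (W * (a j * a (j + 1)))⁻¹ := by group
    rw [h2, h3]

/-- An odd column of crossings conjugates by a power of the product of its two strands. -/
theorem reads_twistColumn_odd (n : ℤ) :
    Reads (twistColumn j (2 * n + 1)) a b ↔
      b = setPair j (((a j * a (j + 1)) ^ n)⁻¹ * a (j + 1) * (a j * a (j + 1)) ^ n)
        (((a j * a (j + 1)) ^ n)⁻¹ * ((a (j + 1))⁻¹ * a j * a (j + 1)) *
          (a j * a (j + 1)) ^ n) a := by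
  rcases n with m | m
  · have h : twistColumn j (2 * Int.ofNat m + 1) =
        cross j true :: List.replicate (2 * m) (cross j true) := by
      rw [twistColumn, ← List.replicate_succ]
      have h1 : (2 * Int.ofNat m + 1).natAbs = 2 * m + 1 := by
        simp only [Int.ofNat_eq_natCast]
        omega
      have h2 : 0 < 2 * Int.ofNat m + 1 := by
        simp only [Int.ofNat_eq_natCast]
        omega
      rw [h1, decide_eq_true h2]
    rw [h]
    simp only [Reads, relates_cross_true_iff, exists_eq_left, reads_two_mul_cross_true,
      setPair_left, setPair_right, setPair_setPair]
    have h1 : a (j + 1) * ((a (j + 1))⁻¹ * a j * a (j + 1)) = a j * a (j + 1) := by group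
    rw [h1]
    simp
  · have h : twistColumn j (2 * Int.negSucc m + 1) =
        cross j false :: List.replicate (2 * m) (cross j false) := by
      rw [twistColumn, ← List.replicate_succ]
      have h1 : (2 * Int.negSucc m + 1).natAbs = 2 * m + 1 := by omega
      have h2 : ¬ 0 < 2 * Int.negSucc m + 1 := by omega
      rw [h1, decide_eq_false h2]
    rw [h]
    simp only [Reads, relates_cross_false_iff, exists_eq_left, reads_two_mul_cross_false,
      setPair_left, setPair_right, setPair_setPair]
    have h1 : a j * a (j + 1) * (a j)⁻¹ * a j = a j * a (j + 1) := by group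
    rw [h1, zpow_negSucc, pow_succ]
    generalize (a j * a (j + 1)) ^ m = W
    have h2 : W * (a j * a (j + 1) * (a j)⁻¹) * W⁻¹ =
        (W * (a j * a (j + 1)))⁻¹⁻¹ * a (j + 1) * (W * (a j * a (j + 1)))⁻¹ := by group
    have h3 : W * a j * W⁻¹ = (W * (a j * a (j + 1)))⁻¹⁻¹ *
        ((a (j + 1))⁻¹ * a j * a (j + 1)) * (W * (a j * a (j + 1)))⁻¹ := by group
    rw [h2, h3]

end Twist

end MorseEvent

/-! ### The knot group as the universal labelling -/

namespace LinkDiagram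

variable (D : LinkDiagram) {F : Type*} [Group F]

/-- The class of `D.gen l j` in the knot group. -/
def strandClass (l j : ℕ) : D.knotGroup := PresentedGroup.mk D.relators (D.gen l j)

theorem relates_strandClass {l : ℕ} {e : MorseEvent} (h : D.events[l]? = some e) :
    e.Relates (D.strandClass l) (D.strandClass (l + 1)) := by
  have key : ∀ x ∈ e.relations (D.gen l) (D.gen (l + 1)),
      PresentedGroup.mk D.relators x.1 = PresentedGroup.mk D.relators x.2 := by
    intro x hx
    rw [← mul_inv_eq_one, ← map_inv, ← map_mul]
    exact (QuotientGroup.eq_one_iff _).mpr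
      (Subgroup.subset_normalClosure ⟨l, e, h, x, hx, rfl⟩)
  have hpush : ∀ x ∈ e.relations (D.strandClass l) (D.strandClass (l + 1)),
      ∃ y ∈ e.relations (D.gen l) (D.gen (l + 1)),
        x = (PresentedGroup.mk D.relators y.1, PresentedGroup.mk D.relators y.2) := by
    intro x hx
    rcases e with j | j | ⟨j, _ | _⟩
    · rcases hx with (rfl | ⟨k, hk, rfl⟩) | ⟨k, hk, rfl⟩
      · exact ⟨_, Or.inl (Or.inl rfl), by simp [strandClass]⟩
      · exact ⟨_, Or.inl (Or.inr ⟨k, hk, rfl⟩), rfl⟩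
      · exact ⟨_, Or.inr ⟨k, hk, rfl⟩, rfl⟩
    · rcases hx with (rfl | ⟨k, hk, rfl⟩) | ⟨k, hk, rfl⟩
      · exact ⟨_, Or.inl (Or.inl rfl), by simp [strandClass]⟩
      · exact ⟨_, Or.inl (Or.inr ⟨k, hk, rfl⟩), rfl⟩
      · exact ⟨_, Or.inr ⟨k, hk, rfl⟩, rfl⟩
    · rcases hx with (rfl | rfl) | ⟨k, hk, hk', rfl⟩
      · exact ⟨_, Or.inl (Or.inl rfl), rfl⟩
      · exact ⟨_, Or.inl (Or.inr rfl), by simp [strandClass]⟩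
      · exact ⟨_, Or.inr ⟨k, hk, hk', rfl⟩, rfl⟩
    · rcases hx with (rfl | rfl) | ⟨k, hk, hk', rfl⟩
      · exact ⟨_, Or.inl (Or.inl rfl), rfl⟩
      · exact ⟨_, Or.inl (Or.inr rfl), by simp [strandClass]⟩
      · exact ⟨_, Or.inr ⟨k, hk, hk', rfl⟩, rfl⟩
  intro x hx
  obtain ⟨y, hy, rfl⟩ := hpush x hx
  exact key y hy

theorem strandClass_zero (j : ℕ) : D.strandClass 0 j = 1 := by
  have : ¬ (0 ≤ D.events.length ∧ j < D.width 0) := by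
    simp [width, strandCount]
  rw [strandClass, gen, dif_neg this, map_one]

theorem strandCount_take (l : ℕ) : strandCount 0 (D.events.take l) = some (D.width l) := by
  have h := D.closed
  rw [← List.take_append_drop l D.events, strandCount_append, Option.bind_eq_some_iff] at h
  obtain ⟨n, hn, -⟩ := h
  rw [width, hn, Option.getD_some]

theorem next_width {l : ℕ} {e : MorseEvent} (h : D.events[l]? = some e) :
    e.next (D.width l) = some (D.width (l + 1)) := by
  have h1 := D.strandCount_take (l + 1)
  have h2 : [e].foldlM MorseEvent.next (D.width l) = e.next (D.width l) := by
    simp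
  rw [List.take_add_one, h, strandCount_append, D.strandCount_take l, Option.bind_some] at h1
  rw [← h1, ← h2]
  rfl

/-- Labels of the strands that satisfy the Wirtinger relations define a homomorphism. -/
theorem exists_hom_of_labels (lab : ℕ → ℕ → F) (h0 : ∀ j, lab 0 j = 1)
    (h : ∀ (l : ℕ) (e : MorseEvent), D.events[l]? = some e →
      e.Relates (lab l) (lab (l + 1))) :
    ∃ φ : D.knotGroup →* F, ∀ l ≤ D.events.length, ∀ j, φ (D.strandClass l j) = lab l j := by
  -- `gen` is `1` at positions without a strand, so the labels have to be trivial there too; this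
  -- propagates downwards from level 0.
  have hsupp : ∀ l ≤ D.events.length, ∀ j ≥ D.width l, lab l j = 1 := by
    intro l
    induction l with
    | zero => exact fun _ j _ => h0 j
    | succ l ih =>
      intro hl
      have he := List.getElem?_eq_getElem (l := D.events) (i := l) (by omega)
      exact (h l _ he).eq_one_of_next (D.next_width he) (ih (by omega))
  let f : D.Strand → F := fun s => lab s.1.1 s.1.2
  have hf : ∀ l ≤ D.events.length, ∀ j, FreeGroup.lift f (D.gen l j) = lab l j := by
    intro l hl j
    unfold gen
    split_ifs with hj
    · exact FreeGroup.lift_apply_of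
    · rw [map_one, hsupp l hl j (by omega)]
  have hrel : ∀ r ∈ D.relators, FreeGroup.lift f r = 1 := by
    rintro _ ⟨l, e, he, x, hx, rfl⟩
    have hl : l < D.events.length := (List.getElem?_eq_some_iff.mp he).1
    rw [map_mul, map_inv, mul_inv_eq_one]
    exact h l e he _ (MorseEvent.map_mem_relations _ (hf l hl.le) (hf (l + 1) hl) hx)
  refine ⟨PresentedGroup.toGroup hrel, fun l hl j => ?_⟩
  rw [← hf l hl j]
  rfl

theorem eq_top_of_strandClass_mem (H : Subgroup D.knotGroup)
    (h : ∀ l ≤ D.events.length, ∀ j, D.strandClass l j ∈ H) : H = ⊤ := by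
  rw [eq_top_iff, ← PresentedGroup.closure_range_of, Subgroup.closure_le]
  rintro _ ⟨s, rfl⟩
  have h1 := h s.1.1 s.2.1 s.1.2
  have h2 : D.gen s.1.1 s.1.2 = FreeGroup.of s := by
    rw [gen, dif_pos s.2]
    rfl
  rwa [strandClass, h2] at h1

end LinkDiagram

/-! ### Generators of the module `G'/G''` -/

namespace MetabelianModule

variable {G : Type*} [Group G] (g : G)

theorem mk_mul (h k : commutator G) : mk g (h * k) = mk g h + mk g k := rfl

theorem mk_inv (h : commutator G) : mk g h⁻¹ = -mk g h := rfl

theorem mk_zpow (h : commutator G) (n : ℤ) : mk g (h ^ n) = n • mk g h := by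
  change Additive.ofMul (Abelianization.of (h ^ n)) = _
  rw [map_zpow, ofMul_zpow]
  rfl

theorem mk_surjective : Function.Surjective (mk g) :=
  fun m => QuotientGroup.mk_surjective m

theorem mk_conjNormal_coe (k h : commutator G) : mk g (MulAut.conjNormal (k : G) h) = mk g h := by
  have : MulAut.conjNormal (k : G) h = k * h * k⁻¹ := Subtype.ext (by simp)
  rw [this, mk_mul, mk_mul, mk_inv]
  abel

/-- A submodule of `G' / G''` is stable under conjugation by every element of `G`, if `G` is
generated by `g` and elements of `G'`. -/
theorem mk_conjNormal_mem_iff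
    (hgen : ∀ H : Subgroup G, g ∈ H → commutator G ≤ H → H = ⊤)
    (S : Submodule (LaurentPolynomial ℤ) (MetabelianModule G g)) (k : G) :
    ∀ h, mk g (MulAut.conjNormal k h) ∈ S ↔ mk g h ∈ S := by
  -- Asking for an equivalence, rather than an implication, makes the condition stable under
  -- inverses.
  let H : Subgroup G :=
    { carrier := {k | ∀ h, mk g (MulAut.conjNormal k h) ∈ S ↔ mk g h ∈ S}
      one_mem' := fun h => by rw [map_one, MulAut.one_apply]
      mul_mem' := fun {k k'} hk hk' h => by
        rw [map_mul, MulAut.mul_apply, hk, hk']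
      inv_mem' := fun {k} hk h => by
        rw [← hk, ← MulAut.mul_apply, ← map_mul, mul_inv_cancel, map_one, MulAut.one_apply] }
  have hH : H = ⊤ := by
    refine hgen H (fun h => ?_) fun k hk h => ?_
    · rw [← T_one_smul_mk]
      refine ⟨fun hm => ?_, fun hm => S.smul_mem _ hm⟩
      have h1 : (LaurentPolynomial.T (-1) * LaurentPolynomial.T 1 : LaurentPolynomial ℤ) = 1 := by
        rw [← LaurentPolynomial.T_add]
        simp
      rw [← one_smul (LaurentPolynomial ℤ) (mk g h), ← h1, mul_smul]
      exact S.smul_mem _ hm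
    · rw [mk_conjNormal_coe g ⟨k, hk⟩]
  have hk : k ∈ H := hH ▸ Subgroup.mem_top k
  exact hk

/-- If `G` is generated by `g` and some elements of `G'`, the classes of these elements generate the
module `G' / G''`. -/
theorem eq_top_of_generators (s : Set (commutator G))
    (hgen : ∀ H : Subgroup G, g ∈ H → (∀ h ∈ s, (h : G) ∈ H) → H = ⊤)
    (S : Submodule (LaurentPolynomial ℤ) (MetabelianModule G g)) (hS : ∀ h ∈ s, mk g h ∈ S) :
    S = ⊤ := by
  have hgen' : ∀ H : Subgroup G, g ∈ H → commutator G ≤ H → H = ⊤ :=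
    fun H h1 h2 => hgen H h1 fun h _ => h2 h.2
  let K' : Subgroup (commutator G) :=
    { carrier := {h | mk g h ∈ S}
      one_mem' := S.zero_mem
      mul_mem' := fun h1 h2 => S.add_mem h1 h2
      inv_mem' := fun h1 => S.neg_mem h1 }
  let K : Subgroup G := K'.map (commutator G).subtype
  have hK : K.Normal := by
    refine ⟨?_⟩
    rintro _ ⟨h, hh, rfl⟩ k
    exact ⟨MulAut.conjNormal k h, (mk_conjNormal_mem_iff g hgen' S k h).mpr hh, by simp⟩
  -- All the given generators except `g` die in `G ⧸ K`, which is therefore cyclic, hence abelian;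
  -- so `K` contains `G'`.
  have hcyc : (Subgroup.zpowers (QuotientGroup.mk' K g)).comap (QuotientGroup.mk' K) = ⊤ := by
    refine hgen _ (Subgroup.mem_zpowers _) fun h hh => ?_
    have : QuotientGroup.mk' K (h : G) = 1 :=
      (QuotientGroup.eq_one_iff _).mpr ⟨h, hS h hh, rfl⟩
    rw [Subgroup.mem_comap, this]
    exact one_mem _
  have hle : commutator G ≤ K := by
    rw [← Subgroup.Normal.quotient_commutative_iff_commutator_le]
    have hz : ∀ q : G ⧸ K, q ∈ Subgroup.zpowers (QuotientGroup.mk' K g) := by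
      intro q
      obtain ⟨k, rfl⟩ := QuotientGroup.mk'_surjective K q
      have : k ∈ (Subgroup.zpowers (QuotientGroup.mk' K g)).comap (QuotientGroup.mk' K) :=
        hcyc ▸ Subgroup.mem_top k
      exact this
    refine ⟨⟨fun p q => ?_⟩⟩
    obtain ⟨m, rfl⟩ := hz p
    obtain ⟨n, rfl⟩ := hz q
    exact (Commute.refl _).zpow_zpow m n
  rw [eq_top_iff]
  rintro m -
  obtain ⟨h, rfl⟩ := mk_surjective g m
  obtain ⟨h', hh', heq⟩ := hle h.2
  obtain rfl : h' = h := Subtype.ext heq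
  exact hh'

end MetabelianModule

/-! ### Linear maps out of `G'/G''` from homomorphisms to affine groups -/

namespace LaurentPolynomial

variable {M N : Type*} [AddCommGroup M] [Module (LaurentPolynomial ℤ) M] [AddCommGroup N]
  [Module (LaurentPolynomial ℤ) N]

/-- An additive map that commutes with `T 1` is linear over `ℤ[T;T⁻¹]`. -/
theorem map_smul_of_map_T_one_smul (f : M →+ N)
    (hf : ∀ m, f ((T 1 : LaurentPolynomial ℤ) • m) = (T 1 : LaurentPolynomial ℤ) • f m)
    (p : LaurentPolynomial ℤ) (m : M) : f (p • m) = p • f m := by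
  have hf' : ∀ m, f ((T (-1) : LaurentPolynomial ℤ) • m) =
      (T (-1) : LaurentPolynomial ℤ) • f m := by
    intro m
    have h1 : (T (-1) * T 1 : LaurentPolynomial ℤ) = 1 := by rw [← T_add]; simp
    have h2 : (T 1 * T (-1) : LaurentPolynomial ℤ) = 1 := by rw [← T_add]; simp
    rw [← one_smul (LaurentPolynomial ℤ) (f (_ • m)), ← h1, mul_smul, ← hf, ← mul_smul, h2,
      one_smul]
  induction p using LaurentPolynomial.induction_on generalizing m with
  | h_C a =>
    have : (C a : LaurentPolynomial ℤ) = (a : LaurentPolynomial ℤ) := by simp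
    rw [this, Int.cast_smul_eq_zsmul, Int.cast_smul_eq_zsmul, map_zsmul]
  | h_add hp hq => rw [add_smul, map_add, hp, hq, add_smul]
  | h_C_mul_T n a h => rw [T_add, ← mul_assoc, mul_smul, h, hf, ← mul_smul]
  | h_C_mul_T_Z n a h => rw [sub_eq_add_neg, T_add, ← mul_assoc, mul_smul, h, hf', ← mul_smul]

end LaurentPolynomial

/-- The group of affine transformations `v ↦ u • v + n` of an `R`-module, `u` a unit. -/
abbrev UnitAffineGroup (R N : Type*) [CommRing R] [AddCommGroup N] [Module R N] : Type _ :=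
  Multiplicative N ⋊[(MulAutMultiplicative N).symm.toMonoidHom.comp
    (DistribMulAction.toAddAut Rˣ N)] Rˣ

namespace UnitAffineGroup

variable {R N : Type*} [CommRing R] [AddCommGroup N] [Module R N]

/-- The translation by `n`. -/
def translation (n : N) : UnitAffineGroup R N := SemidirectProduct.inl (Multiplicative.ofAdd n)

/-- The scalar multiplication by `u`. -/
def scaling (u : Rˣ) : UnitAffineGroup R N := SemidirectProduct.inr u

theorem translation_add (n n' : N) :
    (translation (n + n') : UnitAffineGroup R N) = translation n * translation n' :=
  map_mul SemidirectProduct.inl _ _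

theorem translation_neg (n : N) :
    (translation (-n) : UnitAffineGroup R N) = (translation n)⁻¹ :=
  map_inv SemidirectProduct.inl _

theorem translation_zsmul (k : ℤ) (n : N) :
    (translation (k • n) : UnitAffineGroup R N) = translation n ^ k :=
  map_zpow SemidirectProduct.inl _ _

/-- This mirrors the action of `t` on `G'/G''`: scalar multiplication of a translation is
conjugation by a scaling. -/
theorem translation_smul (u : Rˣ) (n : N) :
    (translation ((u : R) • n) : UnitAffineGroup R N) =
      scaling u * translation n * (scaling u)⁻¹ := by
  rw [scaling, ← map_inv]
  exact SemidirectProduct.inl_aut (φ := (MulAutMultiplicative N).symm.toMonoidHom.comp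
    (DistribMulAction.toAddAut Rˣ N)) u (Multiplicative.ofAdd n)

end UnitAffineGroup

namespace MetabelianModule

open UnitAffineGroup

variable {G N : Type*} [Group G] [AddCommGroup N] [Module (LaurentPolynomial ℤ) N]

/-- A homomorphism from `G` to an affine group induces a linear map on `G' / G''`. -/
theorem exists_linearMap_of_hom (g : G) (u : (LaurentPolynomial ℤ)ˣ)
    (hu : (u : LaurentPolynomial ℤ) = LaurentPolynomial.T 1)
    (φ : G →* UnitAffineGroup (LaurentPolynomial ℤ) N) (hg : φ g = scaling u) :
    ∃ ψ : MetabelianModule G g →ₗ[LaurentPolynomial ℤ] N,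
      ∀ (h : commutator G) (n : N), φ h = translation n → ψ (mk g h) = n := by
  -- The group of scalings is commutative, so commutators are sent to translations.
  have hright : ∀ h : commutator G, (φ h).right = 1 := fun h =>
    Abelianization.commutator_subset_ker (SemidirectProduct.rightHom.comp φ) h.2
  let θ : commutator G →* Multiplicative N :=
    { toFun := fun h => (φ h).left
      map_one' := by simp
      map_mul' := fun h k => by simp [hright] }
  have hθ : ∀ h : commutator G, φ h = translation (Multiplicative.toAdd (θ h)) := fun h =>
    SemidirectProduct.ext rfl (hright h)
  let ψ : MetabelianModule G g →+ N := MonoidHom.toAdditiveLeft (Abelianization.lift θ)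
  have hψ : ∀ (h : commutator G) (n : N), φ h = translation n → ψ (mk g h) = n := by
    intro h n hn
    have h1 : ψ (mk g h) = Multiplicative.toAdd (θ h) := rfl
    rw [h1]
    change Multiplicative.toAdd (φ h).left = n
    rw [hn]
    rfl
  have hT : ∀ m, ψ ((LaurentPolynomial.T 1 : LaurentPolynomial ℤ) • m) =
      (LaurentPolynomial.T 1 : LaurentPolynomial ℤ) • ψ m := by
    intro m
    obtain ⟨h, rfl⟩ := mk_surjective g m
    rw [T_one_smul_mk, hψ h _ (hθ h), ← hu]
    apply hψ
    rw [translation_smul, ← hθ, ← hg]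
    simp
  exact ⟨{ ψ with
    map_smul' := LaurentPolynomial.map_smul_of_map_T_one_smul ψ hT }, hψ⟩

end MetabelianModule

/-- The relations of the group of the pretzel knot `P(2a + 1, 2b + 1, 2c + 1)`, in terms of a meridian
`x` and of the products `v`, `w` of the two strands of the first and second columns. -/
def PretzelRelations {G : Type*} [Group G] (a b c : ℤ) (x v w : G) : Prop :=
  (v ^ (a + 1))⁻¹ * (x * v ^ (a + 1) * x⁻¹) = (w ^ b)⁻¹ * (v * w)⁻¹ * (x * w ^ b * x⁻¹) ∧
  (v * w) ^ c * (x * ((v * w) ^ c)⁻¹ * x⁻¹) =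
    (w ^ (b + 1))⁻¹ * v⁻¹ * (x * w ^ (b + 1) * x⁻¹)

/-! ### Group relations read off the pretzel diagram -/

section Diagram

open MorseEvent

variable {F : Type*} [Group F]

/-- The labels of the six strands below the three maxima of a pretzel diagram. -/
def topLabels (x v w : F) : ℕ → F
  | 0 => x
  | 1 => x⁻¹ * v
  | 2 => v⁻¹ * x
  | 3 => x⁻¹ * v * w
  | 4 => (x⁻¹ * v * w)⁻¹
  | 5 => x⁻¹
  | _ => 1

/-- Each column is solved by `reads_twistColumn_odd`; the caps at 3 and 1 then give the two
relations. The cap at 0 adds nothing: its condition follows from these two, as one Wirtinger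
relation is always redundant. -/
theorem reads_pretzel_columns_iff (a b c : ℤ) (x v w : F) :
    (∃ s, Reads (twistColumn 0 (2 * a + 1) ++ (twistColumn 2 (2 * b + 1) ++
      (twistColumn 4 (2 * c + 1) ++ [cap 3, cap 1, cap 0]))) (topLabels x v w) s) ↔
      PretzelRelations a b c x v w := by
  simp only [reads_append, reads_twistColumn_odd, Reads, relates_cap_iff, exists_eq_left, existsAndEq]
  have hv : w⁻¹ * (v⁻¹ * x) * x⁻¹ = (v * w)⁻¹ := by group
  have hw : v⁻¹ * x * (x⁻¹ * v * w) = w := by group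
  -- Once the powers are generalized to `A`, `B`, `C`, their commutation with the bases is all that
  -- the redundant relation needs.
  have hA : (v ^ a) * v = v * v ^ a := (Commute.refl v).zpow_left a
  have hB : (w ^ b) * w = w * w ^ b := (Commute.refl w).zpow_left b
  have hC : (v * w) ^ c * (v * w) = v * w * (v * w) ^ c := (Commute.refl (v * w)).zpow_left c
  simp [topLabels, setPair]
  rw [PretzelRelations, hv, hw, inv_zpow, add_comm a, add_comm b, zpow_one_add, zpow_one_add]
  generalize v ^ a = A at *
  generalize w ^ b = B at *
  generalize (v * w) ^ c = C at *
  constructor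
  · rintro ⟨h1, h2, -⟩
    constructor
    · calc (v * A)⁻¹ * (x * (v * A) * x⁻¹) = (A⁻¹ * (v⁻¹ * (x⁻¹ * v) * A))⁻¹ * x⁻¹ := by group
        _ = (B⁻¹ * (x⁻¹ * v * w) * B)⁻¹ * x⁻¹ := by rw [h2]
        _ = B⁻¹ * (v * w)⁻¹ * (x * B * x⁻¹) := by group
    · calc C * (x * C⁻¹ * x⁻¹) = (C⁻¹⁻¹ * x⁻¹ * C⁻¹)⁻¹ * x⁻¹ := by group
        _ = (B⁻¹ * (w⁻¹ * (v⁻¹ * x) * (x⁻¹ * v * (x⁻¹ * v * w)) * B))⁻¹ * x⁻¹ := by rw [h1]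
        _ = (w * B)⁻¹ * v⁻¹ * (x * (w * B) * x⁻¹) := by group
  · rintro ⟨h1, h2⟩
    refine ⟨?_, ?_, ?_⟩
    · calc C⁻¹⁻¹ * x⁻¹ * C⁻¹ = (C * (x * C⁻¹ * x⁻¹) * x)⁻¹ := by group
        _ = ((w * B)⁻¹ * v⁻¹ * (x * (w * B) * x⁻¹) * x)⁻¹ := by rw [h2]
        _ = B⁻¹ * (w⁻¹ * (v⁻¹ * x) * (x⁻¹ * v * (x⁻¹ * v * w)) * B) := by group
    · calc B⁻¹ * (x⁻¹ * v * w) * B = (B⁻¹ * (v * w)⁻¹ * (x * B * x⁻¹) * x)⁻¹ := by group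
        _ = ((v * A)⁻¹ * (x * (v * A) * x⁻¹) * x)⁻¹ := by rw [h1]
        _ = A⁻¹ * (v⁻¹ * (x⁻¹ * v) * A) := by group
    · have hC' : (v * w)⁻¹ * C⁻¹ = C⁻¹ * (v * w)⁻¹ := by rw [← mul_inv_rev, ← mul_inv_rev, hC]
      calc C⁻¹⁻¹ * (x * (w⁻¹ * (v⁻¹ * x)) * x⁻¹) * C⁻¹ = C * x * ((v * w)⁻¹ * C⁻¹) := by group
        _ = C * (x * C⁻¹ * x⁻¹) * x * (v * w)⁻¹ := by rw [hC']; group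
        _ = (w * B)⁻¹ * v⁻¹ * x * (w * B) * (v * w)⁻¹ := by rw [h2]; group
        _ = (w * B)⁻¹ * v⁻¹ * x * (B * w) * (v * w)⁻¹ := by rw [hB]
        _ = (B⁻¹ * (v * w)⁻¹ * (x * B * x⁻¹)) * x * v⁻¹ := by group
        _ = A⁻¹ * v⁻¹ * x * (v * A) * v⁻¹ := by rw [← h1]; group
        _ = A⁻¹ * (v⁻¹ * x * A) := by rw [← hA]; group

end Diagram

/-! ### The presentation matrix of the Alexander module -/

section Module

open LaurentPolynomial MetabelianModule UnitAffineGroup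

/-- The presentation matrix of the Alexander module of `P(2a + 1, 2b + 1, 2c + 1)`. -/
noncomputable def pretzelMatrix (a b c : ℤ) : Matrix (Fin 2) (Fin 2) (LaurentPolynomial ℤ) :=
  !![(T 1 - 1) * ((a + 1 : ℤ) : LaurentPolynomial ℤ) + 1,
      1 - (T 1 - 1) * (c : LaurentPolynomial ℤ);
    1 - (T 1 - 1) * (b : LaurentPolynomial ℤ),
      -((T 1 - 1) * ((b + c + 1 : ℤ) : LaurentPolynomial ℤ))]

/-- In an affine group over a module, the pretzel relations are two linear relations. -/
theorem pretzelRelations_translation {N : Type*} [AddCommGroup N] [Module (LaurentPolynomial ℤ) N]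
    (a b c : ℤ) (u : (LaurentPolynomial ℤ)ˣ) (hu : (u : LaurentPolynomial ℤ) = T 1) (p q : N)
    (h : ∀ j, pretzelMatrix a b c 0 j • p + pretzelMatrix a b c 1 j • q = 0) :
    PretzelRelations a b c (scaling u) (translation p)
      (translation q : UnitAffineGroup (LaurentPolynomial ℤ) N) := by
  have h0 := h 0
  have h1 := h 1
  simp only [pretzelMatrix, Matrix.of_apply, Matrix.cons_val', Matrix.cons_val_zero,
    Matrix.cons_val_one, Matrix.cons_val_fin_one] at h0 h1
  constructor
  · simp only [← translation_add, ← translation_zsmul, ← translation_neg, ← translation_smul, hu]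
    congr 1
    rw [← sub_eq_zero, ← h0]
    simp only [← Int.cast_smul_eq_zsmul (LaurentPolynomial ℤ)]
    push_cast
    module
  · simp only [← translation_add, ← translation_zsmul, ← translation_neg, ← translation_smul, hu]
    congr 1
    rw [← sub_eq_zero, ← h1]
    simp only [← Int.cast_smul_eq_zsmul (LaurentPolynomial ℤ)]
    push_cast
    module

/-- Both sides of each relation are products of elements of `G'`, where `x` occurs only as a
conjugator. In `G'/G''` products become sums and conjugation by `x` becomes `t`. -/
theorem PretzelRelations.smul_mk_add_smul_mk {G : Type*} [Group G] {a b c : ℤ} {x : G}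
    {v w : commutator G} (h : PretzelRelations a b c x (v : G) w) (j : Fin 2) :
    pretzelMatrix a b c 0 j • mk x v + pretzelMatrix a b c 1 j • mk x w = 0 := by
  obtain ⟨h0, h1⟩ := h
  have h0' : (v ^ (a + 1))⁻¹ * MulAut.conjNormal x (v ^ (a + 1)) =
      (w ^ b)⁻¹ * (v * w)⁻¹ * MulAut.conjNormal x (w ^ b) := by
    apply Subtype.ext
    exact h0
  have h1' : (v * w) ^ c * MulAut.conjNormal x ((v * w) ^ c)⁻¹ =
      (w ^ (b + 1))⁻¹ * v⁻¹ * MulAut.conjNormal x (w ^ (b + 1)) := by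
    apply Subtype.ext
    exact h1
  replace h0' := congrArg (mk x) h0'
  replace h1' := congrArg (mk x) h1'
  simp only [mk_mul, ← T_one_smul_mk, mk_zpow, mk_inv,
    ← Int.cast_smul_eq_zsmul (LaurentPolynomial ℤ)] at h0' h1'
  push_cast at h0' h1'
  rw [← sub_eq_zero] at h0' h1'
  fin_cases j
  · rw [← h0']
    simp only [pretzelMatrix, Matrix.of_apply, Matrix.cons_val', Matrix.cons_val_zero,
      Matrix.cons_val_one, Matrix.cons_val_fin_one, Fin.zero_eta]
    push_cast
    module
  · rw [← h1']
    simp only [pretzelMatrix, Matrix.of_apply, Matrix.cons_val', Matrix.cons_val_zero,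
      Matrix.cons_val_one, Matrix.cons_val_fin_one, Fin.mk_one]
    push_cast
    module

theorem map_mulVecLin_single (A : Matrix (Fin 2) (Fin 2) (LaurentPolynomial ℤ))
    {M : Type*} [AddCommGroup M] [Module (LaurentPolynomial ℤ) M]
    (f : (Fin 2 → LaurentPolynomial ℤ) →ₗ[LaurentPolynomial ℤ] M) (j : Fin 2) :
    f (A.mulVecLin (Pi.single j 1)) =
      A 0 j • f (Pi.single 0 1) + A 1 j • f (Pi.single 1 1) := by
  rw [Matrix.mulVecLin_apply, Matrix.mulVec_single_one, ← map_smul, ← map_smul, ← map_add]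
  congr 1
  ext i
  fin_cases i <;> simp

/-- The module `G' / G''` of a group `G` with the presentation of a pretzel knot group. -/
theorem isPresentationMatrix_of_pretzelRelations {G : Type} [Group G] {a b c : ℤ} {x v w : G}
    (h : PretzelRelations a b c x v w) (hv : v ∈ commutator G) (hw : w ∈ commutator G)
    (hgen : ∀ H : Subgroup G, x ∈ H → v ∈ H → w ∈ H → H = ⊤)
    (huniv : ∀ {F : Type} [Group F] {x' v' w' : F}, PretzelRelations a b c x' v' w' →
      ∃ φ : G →* F, φ x = x' ∧ φ v = v' ∧ φ w = w') :
    IsPresentationMatrix (pretzelMatrix a b c) (MetabelianModule G x) := by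
  let Λ := LaurentPolynomial ℤ
  let p : Fin 2 → MetabelianModule G x := ![mk x ⟨v, hv⟩, mk x ⟨w, hw⟩]
  let f : (Fin 2 → Λ) →ₗ[Λ] MetabelianModule G x := Fintype.linearCombination Λ p
  have hf : ∀ i, f (Pi.single i 1) = p i := fun i => by
    simp [f, Fintype.linearCombination_apply_single]
  refine ⟨f, ?_, le_antisymm ?_ ?_⟩
  · rw [← LinearMap.range_eq_top]
    refine eq_top_of_generators x {⟨v, hv⟩, ⟨w, hw⟩} (fun H h1 h2 => ?_) _ ?_
    · exact hgen H h1 (h2 _ (Or.inl rfl)) (h2 _ (Or.inr rfl))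
    · rintro _ (rfl | rfl)
      · exact ⟨_, hf 0⟩
      · exact ⟨_, hf 1⟩
  -- For the kernel, the classes of the basis vectors in the cokernel `N` give translations
  -- satisfying the relations. The resulting linear map `ψ` satisfies `ψ ∘ f = π`, so whatever `f`
  -- kills is already zero in `N`.
  · let N := (Fin 2 → Λ) ⧸ LinearMap.range (pretzelMatrix a b c).mulVecLin
    let π : (Fin 2 → Λ) →ₗ[Λ] N := Submodule.mkQ _
    let u : Λˣ := (isUnit_T (R := ℤ) 1).unit
    have hu : (u : Λ) = T 1 := rfl
    obtain ⟨φ, hx, hv', hw'⟩ := huniv (pretzelRelations_translation a b c u hu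
      (π (Pi.single 0 1)) (π (Pi.single 1 1)) fun j => by
        rw [← map_mulVecLin_single]
        exact (Submodule.Quotient.mk_eq_zero _).mpr ⟨_, rfl⟩)
    obtain ⟨ψ, hψ⟩ := exists_linearMap_of_hom x u hu φ hx
    have hcomp : ψ ∘ₗ f = π := by
      refine LinearMap.pi_ext' fun i => LinearMap.ext_ring ?_
      simp only [LinearMap.comp_apply, LinearMap.single_apply, hf]
      fin_cases i
      · exact hψ _ _ hv'
      · exact hψ _ _ hw'
    intro y hy
    rw [LinearMap.mem_ker] at hy
    have h1 := LinearMap.congr_fun hcomp y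
    rw [LinearMap.comp_apply, hy, map_zero] at h1
    exact (Submodule.Quotient.mk_eq_zero _).mp h1.symm
  · rw [LinearMap.range_le_ker_iff]
    refine LinearMap.pi_ext' fun j => LinearMap.ext_ring ?_
    simp only [LinearMap.comp_apply, LinearMap.single_apply, LinearMap.zero_apply]
    rw [map_mulVecLin_single, hf, hf]
    exact h.smul_mk_add_smul_mk (v := ⟨v, hv⟩) (w := ⟨w, hw⟩) j

end Module

theorem PretzelRelations.map {G F : Type*} [Group G] [Group F] (φ : G →* F) {a b c : ℤ}
    {x v w : G} (h : PretzelRelations a b c x v w) :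
    PretzelRelations a b c (φ x) (φ v) (φ w) := by
  constructor
  · simpa only [map_mul, map_inv, map_zpow] using congrArg φ h.1
  · simpa only [map_mul, map_inv, map_zpow] using congrArg φ h.2

/-- Without conjugation the relations reduce to `vw = 1` and `v = 1`. -/
theorem PretzelRelations.eq_one {A : Type*} [CommGroup A] {a b c : ℤ} {x v w : A}
    (h : PretzelRelations a b c x v w) : v = 1 ∧ w = 1 := by
  obtain ⟨h1, h2⟩ := h
  rw [mul_comm x, mul_inv_cancel_right, inv_mul_cancel, mul_comm x, mul_inv_cancel_right,
    mul_comm (w ^ b)⁻¹, inv_mul_cancel_right, eq_comm, inv_eq_one] at h1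
  rw [mul_comm x, mul_inv_cancel_right, mul_inv_cancel, mul_comm x, mul_inv_cancel_right,
    mul_comm (w ^ (b + 1))⁻¹, inv_mul_cancel_right, eq_comm, inv_eq_one] at h2
  exact ⟨h2, by rwa [h2, one_mul] at h1⟩

theorem PretzelRelations.mem_commutator {G : Type*} [Group G] {a b c : ℤ}
    {x v w : G} (h : PretzelRelations a b c x v w) : v ∈ commutator G ∧ w ∈ commutator G := by
  rw [← Abelianization.ker_of]
  exact (h.map Abelianization.of).eq_one

/-! ### The group and Alexander module of the pretzel diagram -/

section KnotGroup

open MorseEvent LinkDiagram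

/-- The part of a pretzel diagram below its maxima. -/
def pretzelTail (p q r : ℤ) : List MorseEvent :=
  twistColumn 0 p ++ (twistColumn 2 q ++ (twistColumn 4 r ++ [cap 3, cap 1, cap 0]))

theorem pretzel_events (p q r : ℤ) :
    (pretzel p q r).events = cup 0 :: cup 1 :: cup 3 :: pretzelTail p q r := by
  simp [pretzel, pretzelTail]

theorem isNotCup_of_mem_pretzelTail {p q r : ℤ} {e : MorseEvent} (he : e ∈ pretzelTail p q r) :
    e.IsNotCup := by
  simp only [pretzelTail, twistColumn, List.mem_append, List.mem_replicate, List.mem_cons,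
    List.not_mem_nil, or_false] at he
  rcases he with ⟨-, rfl⟩ | ⟨-, rfl⟩ | ⟨-, rfl⟩ | rfl | rfl | rfl <;> trivial

/-- The product of the two strands of the first column of a pretzel diagram. -/
def pretzelFirst (D : LinkDiagram) : D.knotGroup := D.strandClass 1 0 * D.strandClass 3 1

/-- The product of the two strands of the second column of a pretzel diagram. -/
def pretzelSecond (D : LinkDiagram) : D.knotGroup := (D.strandClass 3 1)⁻¹ * D.strandClass 3 3

variable (p q r : ℤ)

theorem pretzel_relates_cups :
    (cup 0).Relates ((pretzel p q r).strandClass 0) ((pretzel p q r).strandClass 1) ∧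
    (cup 1).Relates ((pretzel p q r).strandClass 1) ((pretzel p q r).strandClass 2) ∧
    (cup 3).Relates ((pretzel p q r).strandClass 2) ((pretzel p q r).strandClass 3) :=
  ⟨relates_strandClass _ (by rw [pretzel_events]; rfl),
    relates_strandClass _ (by rw [pretzel_events]; rfl),
    relates_strandClass _ (by rw [pretzel_events]; rfl)⟩

theorem pretzel_strandClass_three :
    (pretzel p q r).strandClass 3 = topLabels ((pretzel p q r).strandClass 1 0)
      (pretzelFirst (pretzel p q r)) (pretzelSecond (pretzel p q r)) := by
  have h0 := (pretzel p q r).strandClass_zero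
  obtain ⟨h1, h2, h3⟩ := pretzel_relates_cups p q r
  unfold pretzelFirst pretzelSecond
  generalize (pretzel p q r).strandClass = s at *
  rw [relates_cup_iff] at h1 h2 h3
  ext k
  match k with
  | 0 => rw [h3.2.1 0 (by omega), h2.2.1 0 (by omega)]; rfl
  | 1 => simp [topLabels]
  | 2 => simp [topLabels, h3.2.1 2 (by omega), h2.1, ← h3.2.1 1 (by omega)]
  | 3 => simp [topLabels]
  | 4 => simp [topLabels, h3.1]
  | 5 => rw [h3.2.2 3 (by omega), h2.2.2 1 (by omega), h1.1]; rfl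
  | k + 6 =>
    rw [h3.2.2 (k + 4) (by omega), h2.2.2 (k + 2) (by omega), h1.2.2 k (by omega), h0]
    rfl

/-- Below the three maxima all labels are words in `x`, `v`, `w`. The earlier levels carry a subset
of these labels, and no later event creates a new one. -/
theorem pretzel_generators (H : Subgroup (pretzel p q r).knotGroup)
    (hx : (pretzel p q r).strandClass 1 0 ∈ H) (hv : pretzelFirst (pretzel p q r) ∈ H)
    (hw : pretzelSecond (pretzel p q r) ∈ H) : H = ⊤ := by
  have hs := pretzel_strandClass_three p q r
  have h3 : ∀ k, (pretzel p q r).strandClass 3 k ∈ H := by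
    intro k
    rw [hs]
    match k with
    | 0 => exact hx
    | 1 => exact mul_mem (inv_mem hx) hv
    | 2 => exact mul_mem (inv_mem hv) hx
    | 3 => exact mul_mem (mul_mem (inv_mem hx) hv) hw
    | 4 => exact inv_mem (mul_mem (mul_mem (inv_mem hx) hv) hw)
    | 5 => exact inv_mem hx
    | k + 6 => exact one_mem H
  obtain ⟨-, hc2, hc3⟩ := pretzel_relates_cups p q r
  rw [relates_cup_iff] at hc2 hc3
  have h2 : ∀ k, (pretzel p q r).strandClass 2 k ∈ H := by
    intro k
    rcases lt_or_ge k 3 with hk | hk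
    · rw [← hc3.2.1 k hk]
      exact h3 _
    · rw [← hc3.2.2 k hk]
      exact h3 _
  have h1 : ∀ k, (pretzel p q r).strandClass 1 k ∈ H := by
    intro k
    rcases lt_or_ge k 1 with hk | hk
    · rw [← hc2.2.1 k hk]
      exact h2 _
    · rw [← hc2.2.2 k hk]
      exact h2 _
  have hl : ∀ l, l + 3 ≤ (pretzel p q r).events.length →
      ∀ k, (pretzel p q r).strandClass (l + 3) k ∈ H := by
    intro l
    induction l with
    | zero => exact fun _ => h3
    | succ l ih =>
      intro hlen
      have he := List.getElem?_eq_getElem (l := (pretzel p q r).events) (i := l + 3) (by omega)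
      have hmem : (pretzelTail p q r)[l]? = some (pretzel p q r).events[l + 3] := by
        rw [← he, pretzel_events]
        rfl
      have := relates_strandClass _ he
      rw [show l + 1 + 3 = l + 3 + 1 by ring]
      exact this.mem_of_isNotCup (isNotCup_of_mem_pretzelTail (List.mem_of_getElem? hmem))
        (ih (by omega))
  refine eq_top_of_strandClass_mem _ H fun l hlen k => ?_
  match l with
  | 0 => rw [strandClass_zero]; exact one_mem H
  | 1 => exact h1 k
  | 2 => exact h2 k
  | l + 3 => exact hl l hlen k

variable (a b c : ℤ)

theorem pretzel_pretzelRelations :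
    letI D := pretzel (2 * a + 1) (2 * b + 1) (2 * c + 1)
    PretzelRelations a b c (D.strandClass 1 0) (pretzelFirst D) (pretzelSecond D) := by
  rw [← reads_pretzel_columns_iff, ← pretzel_strandClass_three]
  refine ⟨_, reads_of_labels
    (fun l => (pretzel (2 * a + 1) (2 * b + 1) (2 * c + 1)).strandClass (l + 3)) fun l e he => ?_⟩
  have h1 : (pretzel (2 * a + 1) (2 * b + 1) (2 * c + 1)).events[l + 3]? = some e := by
    rw [pretzel_events]
    exact he
  have h2 := relates_strandClass _ h1
  rwa [show l + 3 + 1 = l + 1 + 3 by ring] at h2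

theorem pretzel_exists_hom {a b c : ℤ} {F : Type*} [Group F] {x v w : F}
    (h : PretzelRelations a b c x v w) :
    letI D := pretzel (2 * a + 1) (2 * b + 1) (2 * c + 1)
    ∃ φ : D.knotGroup →* F,
      φ (D.strandClass 1 0) = x ∧ φ (pretzelFirst D) = v ∧ φ (pretzelSecond D) = w := by
  obtain ⟨s, hs⟩ := (reads_pretzel_columns_iff a b c x v w).mpr h
  obtain ⟨lab, hlab0, hlab⟩ := hs.exists_labels
  -- The levels between the maxima are recovered upwards, deleting first the pair born at position
  -- 3, then the pair born at position 1.
  let top2 : ℕ → F := fun k => if k < 3 then topLabels x v w k else topLabels x v w (k + 2)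
  let top1 : ℕ → F := fun k => if k < 1 then top2 k else top2 (k + 2)
  let full : ℕ → ℕ → F
    | 0 => fun _ => 1
    | 1 => top1
    | 2 => top2
    | l + 3 => lab l
  obtain ⟨φ, hφ⟩ := (pretzel (2 * a + 1) (2 * b + 1) (2 * c + 1)).exists_hom_of_labels full
    (fun _ => rfl) (by
      rw [pretzel_events]
      intro l e he
      match l with
      | 0 =>
        obtain rfl : cup 0 = e := by simpa using he
        refine relates_cup_iff.mpr ⟨rfl, by simp, fun k _ => ?_⟩
        simp [full, top1, top2, topLabels]
      | 1 =>
        obtain rfl : cup 1 = e := by simpa using he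
        refine relates_cup_iff.mpr ⟨by simp [full, top2, topLabels], fun k hk => ?_, fun k hk => ?_⟩
        · simp [full, top1, Nat.lt_one_iff.mp hk]
        · simp [full, top1, Nat.ne_of_gt hk]
      | 2 =>
        obtain rfl : cup 3 = e := by simpa using he
        change (cup 3).Relates top2 (lab 0)
        rw [hlab0]
        refine relates_cup_iff.mpr ⟨rfl, fun k hk => ?_, fun k hk => ?_⟩
        · simp [top2, hk]
        · simp [top2, not_lt.mpr hk]
      | l + 3 => exact hlab l e he)
  have hlen : 3 ≤ (pretzel (2 * a + 1) (2 * b + 1) (2 * c + 1)).events.length := by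
    rw [pretzel_events]
    simp
  have h1 := hφ 1 (by omega)
  have h3 := hφ 3 hlen
  have e3 : full 3 = topLabels x v w := hlab0
  rw [e3] at h3
  refine ⟨φ, h1 0, ?_, ?_⟩
  · rw [pretzelFirst, map_mul, h1, h3]
    simp [full, top1, top2, topLabels]
  · rw [pretzelSecond, map_mul, map_inv, h3, h3]
    simp only [topLabels]
    group

theorem pretzel_isPresentationMatrix :
    IsPresentationMatrix (pretzelMatrix a b c)
      (pretzel (2 * a + 1) (2 * b + 1) (2 * c + 1)).AlexanderModule :=
  isPresentationMatrix_of_pretzelRelations (pretzel_pretzelRelations a b c)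
    (pretzel_pretzelRelations a b c).mem_commutator.1
    (pretzel_pretzelRelations a b c).mem_commutator.2 (pretzel_generators _ _ _)
    fun h => pretzel_exists_hom h

theorem pretzel_alexanderIdeal (r : ℕ) :
    (pretzel (2 * a + 1) (2 * b + 1) (2 * c + 1)).alexanderIdeal r =
      minorIdeal (3 - r) (pretzelMatrix a b c) :=
  elementaryIdeal_eq_minorIdeal (pretzel_isPresentationMatrix a b c) r

end KnotGroup

/-! ### Computation of the elementary ideals -/

section Ideals

open LaurentPolynomial

theorem Ideal.mem_span_triple_iff {R : Type*} [CommRing R] {w x y z : R} :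
    w ∈ Ideal.span {x, y, z} ↔ ∃ a b c, a * x + b * y + c * z = w :=
  Submodule.mem_span_triple

theorem det_pretzelMatrix (i : ℤ) :
    (pretzelMatrix (-2) 1 i).det = 2 * T 2 - 5 * T 1 + 2 := by
  have h : (T 2 : LaurentPolynomial ℤ) = T 1 * T 1 := by
    rw [← T_add]
    rfl
  rw [Matrix.det_fin_two, h]
  simp only [pretzelMatrix, Matrix.of_apply, Matrix.cons_val', Matrix.cons_val_zero,
    Matrix.cons_val_one, Matrix.cons_val_fin_one]
  push_cast
  ring

theorem pretzel_neg_three_three_alexanderIdeal (i : ℤ) (r : ℕ) :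
    (pretzel (-3) 3 (2 * i + 1)).alexanderIdeal r =
      minorIdeal (3 - r) (pretzelMatrix (-2) 1 i) := by
  have h := pretzel_alexanderIdeal (-2) 1 i r
  rwa [show (2 * (-2) + 1 : ℤ) = -3 by norm_num, show (2 * 1 + 1 : ℤ) = 3 by norm_num] at h

/-- The first elementary ideal of `P(-3, 3, 2i + 1)`. -/
theorem pretzel_alexanderIdeal_one (i : ℤ) :
    (pretzel (-3) 3 (2 * i + 1)).alexanderIdeal 1 =
      Ideal.span {(2 * T 2 - 5 * T 1 + 2 : LaurentPolynomial ℤ)} := by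
  rw [pretzel_neg_three_three_alexanderIdeal, show 3 - 1 = 2 from rfl, minorIdeal_self,
    det_pretzelMatrix]

/-- The second elementary ideal of `P(-3, 3, 2i + 1)`. -/
theorem pretzel_alexanderIdeal_two (i : ℤ) :
    (pretzel (-3) 3 (2 * i + 1)).alexanderIdeal 2 =
      Ideal.span {(T 1 - 2 : LaurentPolynomial ℤ), 2 * T 1 - 1,
        ((i - 1 : ℤ) : LaurentPolynomial ℤ)} := by
  rw [pretzel_neg_three_three_alexanderIdeal, show 3 - 2 = 1 from rfl, minorIdeal_one]
  apply le_antisymm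
  · rw [Ideal.span_le]
    rintro _ ⟨j, k, rfl⟩
    rw [SetLike.mem_coe, Ideal.mem_span_triple_iff]
    fin_cases j <;> fin_cases k <;>
      simp only [pretzelMatrix, Matrix.of_apply, Matrix.cons_val', Matrix.cons_val_zero,
        Matrix.cons_val_one, Matrix.cons_val_fin_one, Fin.zero_eta, Fin.mk_one]
    · exact ⟨-1, 0, 0, by push_cast; ring⟩
    · exact ⟨-1, 0, 1 - T 1, by push_cast; ring⟩
    · exact ⟨-1, 0, 0, by push_cast; ring⟩
    · exact ⟨2 * (T 1 - 1), -(T 1 - 1), -(T 1 - 1), by push_cast; ring⟩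
  · have hmem : ∀ j k, pretzelMatrix (-2) 1 i j k ∈
        Ideal.span {d | ∃ j k, d = pretzelMatrix (-2) 1 i j k} :=
      fun j k => Ideal.subset_span ⟨j, k, rfl⟩
    -- The two entries of the first column are equal, so three entries suffice: `t - 2` is minus the
    -- first, `2t - 1` is the difference of the entries of the second column, and `i - 1` comes from
    -- eliminating `t` between `2 - t` and `1 - (t - 1)i`.
    have h00 := hmem 0 0
    have h01 := hmem 0 1
    have h11 := hmem 1 1
    generalize Ideal.span {d | ∃ j k, d = pretzelMatrix (-2) 1 i j k} = I at *
    simp only [pretzelMatrix, Matrix.of_apply, Matrix.cons_val', Matrix.cons_val_zero,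
      Matrix.cons_val_one, Matrix.cons_val_fin_one] at h00 h01 h11
    rw [Ideal.span_le]
    rintro _ (rfl | rfl | rfl)
    · rw [SetLike.mem_coe]
      convert I.neg_mem h00 using 1
      push_cast
      ring
    · rw [SetLike.mem_coe]
      convert I.sub_mem h01 h11 using 1
      push_cast
      ring
    · rw [SetLike.mem_coe]
      convert I.sub_mem (I.mul_mem_left (i : LaurentPolynomial ℤ) h00) h01 using 1
      push_cast
      ring

theorem pretzel_alexanderIdeal_of_three_le (i : ℤ) {r : ℕ} (hr : 3 ≤ r) :
    (pretzel (-3) 3 (2 * i + 1)).alexanderIdeal r = ⊤ := by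
  rw [pretzel_neg_three_three_alexanderIdeal, Nat.sub_eq_zero_of_le hr, minorIdeal_eq_minorSpan,
    minorSpan_zero]

theorem pretzel_alexanderIdeal_eq_of_two_eq {i i' : ℤ}
    (h : (pretzel (-3) 3 (2 * i + 1)).alexanderIdeal 2 =
      (pretzel (-3) 3 (2 * i' + 1)).alexanderIdeal 2) {r : ℕ} (hr : 1 ≤ r) :
    (pretzel (-3) 3 (2 * i + 1)).alexanderIdeal r =
      (pretzel (-3) 3 (2 * i' + 1)).alexanderIdeal r := by
  obtain rfl | rfl | hr : r = 1 ∨ r = 2 ∨ 3 ≤ r := by omega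
  · rw [pretzel_alexanderIdeal_one, pretzel_alexanderIdeal_one]
  · exact h
  · rw [pretzel_alexanderIdeal_of_three_le _ hr, pretzel_alexanderIdeal_of_three_le _ hr]

/-- For `i ≡ 1` modulo `3` the second elementary ideal of `P(-3, 3, 2i + 1)` is proper. -/
theorem pretzel_alexanderIdeal_two_of_one_mod_three (k : ℤ) :
    (pretzel (-3) 3 (2 * (3 * k - 2) + 1)).alexanderIdeal 2 =
      Ideal.span {(T 1 - 2 : LaurentPolynomial ℤ), 2 * T 1 - 1} := by
  rw [pretzel_alexanderIdeal_two]
  apply le_antisymm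
  · rw [Ideal.span_le]
    rintro _ (rfl | rfl | rfl)
    · exact Ideal.subset_span (Or.inl rfl)
    · exact Ideal.subset_span (Or.inr rfl)
    · rw [SetLike.mem_coe, Ideal.mem_span_pair]
      -- Here `i - 1 = 3(k - 1)`, and `3 = (2t - 1) - 2(t - 2)`.
      exact ⟨-2 * (k - 1), k - 1, by push_cast; ring⟩
  · apply Ideal.span_mono
    rintro _ (rfl | rfl)
    exacts [Or.inl rfl, Or.inr (Or.inl rfl)]

/-- For `i ≡ 2` modulo `3` the second elementary ideal of `P(-3, 3, 2i + 1)` is trivial. -/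
theorem pretzel_alexanderIdeal_two_of_two_mod_three (k : ℤ) :
    (pretzel (-3) 3 (2 * (3 * k - 1) + 1)).alexanderIdeal 2 = ⊤ := by
  rw [pretzel_alexanderIdeal_two, Ideal.eq_top_iff_one, Ideal.mem_span_triple_iff]
  -- Here `i - 1 = 3(k - 1) + 1`, from which the multiple `3(k - 1)` of `3 = (2t - 1) - 2(t - 2)` is
  -- subtracted.
  exact ⟨2 * (k - 1), -(k - 1), 1, by push_cast; ring⟩

end Ideals

theorem theorem2p1 :
    -- the Alexander polynomial of `P(-3, 3, 2i + 1)`, for every `i ≥ 1`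
    (∀ i : ℕ, 1 ≤ i →
      (pretzel (-3) 3 (2 * (i : ℤ) + 1)).IsAlexanderPolynomial
        (2 * LaurentPolynomial.T 2 - 5 * LaurentPolynomial.T 1 + 2)) ∧
    -- the subfamily `i = 3k - 2`: identical elementary ideals, and the second one
    (∀ k k' : ℕ, 1 ≤ k → 1 ≤ k' → ∀ r : ℕ, 1 ≤ r →
      (pretzel (-3) 3 (2 * (3 * (k : ℤ) - 2) + 1)).alexanderIdeal r =
        (pretzel (-3) 3 (2 * (3 * (k' : ℤ) - 2) + 1)).alexanderIdeal r) ∧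
    (∀ k : ℕ, 1 ≤ k →
      (pretzel (-3) 3 (2 * (3 * (k : ℤ) - 2) + 1)).alexanderIdeal 2 =
        Ideal.span {LaurentPolynomial.T 1 - 2, 2 * LaurentPolynomial.T 1 - 1}) ∧
    -- the subfamily `i = 3k - 1`: identical elementary ideals, the second one being everything
    (∀ k k' : ℕ, 1 ≤ k → 1 ≤ k' → ∀ r : ℕ, 1 ≤ r →
      (pretzel (-3) 3 (2 * (3 * (k : ℤ) - 1) + 1)).alexanderIdeal r =
        (pretzel (-3) 3 (2 * (3 * (k' : ℤ) - 1) + 1)).alexanderIdeal r) ∧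
    (∀ k : ℕ, 1 ≤ k →
      (pretzel (-3) 3 (2 * (3 * (k : ℤ) - 1) + 1)).alexanderIdeal 2 = ⊤) := by
  refine ⟨fun i _ => ?_, fun k k' _ _ r hr => ?_, fun k _ => ?_, fun k k' _ _ r hr => ?_,
    fun k _ => ?_⟩
  · rw [LinkDiagram.IsAlexanderPolynomial, pretzel_alexanderIdeal_one]
    -- The first elementary ideal is itself principal, so it is the least principal ideal containing
    -- it.
    exact ⟨⟨⟨_, rfl⟩, le_rfl⟩, fun _ hI => hI.2⟩
  · apply pretzel_alexanderIdeal_eq_of_two_eq _ hr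
    rw [pretzel_alexanderIdeal_two_of_one_mod_three, pretzel_alexanderIdeal_two_of_one_mod_three]
  · exact pretzel_alexanderIdeal_two_of_one_mod_three k
  · apply pretzel_alexanderIdeal_eq_of_two_eq _ hr
    rw [pretzel_alexanderIdeal_two_of_two_mod_three, pretzel_alexanderIdeal_two_of_two_mod_three]
  · exact pretzel_alexanderIdeal_two_of_two_mod_three k
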